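/- Let $s\ge 1$, $m\ge t\ge 0$ and $r\ge 1$ be integers, $n=2^m$, and let $f:[0,1]^s\to\mathbb{R}$ be square integrable with $\mu=\int_{[0,1]^s}f(\boldsymbol{x})\,\mathrm{d}\boldsymbol{x}$. Let $C_1,\dots,C_s\in\{0,1\}^{m\times m}$ generate a digital $(t,m,s)$-net in base $2$. That is, for $0\le i<2^m$ let $\vec{i}=(i_1,\dots,i_m)^{\mathsf T}$ where $i=\sum_{\ell=1}^m i_\ell 2^{\ell-1}$, and let $\boldsymbol{a}_i\in[0,1)^s$ be the point whose $j$-th coordinate has the binary digits $C_j\vec{i}\bmod 2$; every elementary interval $\prod_{j=1}^s[c_j2^{-k_j},(c_j+1)2^{-k_j})$ with integers $k_j\ge0$, $0\le c_j<2^{k_j}$ and $\sum_j k_j=m-t$ contains exactly $2^t$ of the points $\boldsymbol{a}_0,\dots,\boldsymbol{a}_{n-1}$. Let $M_1,\dots,M_s\in\{0,1\}^{\infty\times m}$ be random lower triangular matrices with ones on the diagonal and let $D_1,\dots,D_s\in\{0,1\}^{\infty}$ be random vectors, where all the entries of the $M_j$ below the diagonal and all the entries of the $D_j$ are independent and uniform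 on $\{0,1\}$. Let $\boldsymbol{x}_i\in[0,1]^s$ be the point with coordinates $x_{ij}=\sum_{\ell\ge1}2^{-\ell}x_{ij\ell}$, where $(x_{ij\ell})_{\ell\ge1}=M_jC_j\vec{i}+D_j\bmod 2$, and put $\hat\mu_\infty=\frac1n\sum_{i=0}^{n-1}f(\boldsymbol{x}_i)$. Let $\delta>0$ and let $\mathcal{A}$ be an event in the underlying probability space with $\Pr(\mathcal{A})\le\delta$, $\Pr(\mathcal{A}^c)>0$ and $\mathbb{E}(\hat\mu_\infty\mid\mathcal{A}^c)=\mu$. Then the sample median $\hat\mu_\infty^{(r)}$ of $2r-1$ independent copies of $\hat\mu_\infty$ satisfies $$ \mathbb{E}\bigl((\hat\mu_\infty^{(r)}-\mu)^2\bigr)\le \frac{\Pr(\mathcal{A}^c)\,\mathrm{Var}(\hat\mu_\infty\mid\mathcal{A}^c)}{\delta}+(8\delta)^r\Delta_n^2, $$ where $$ \Delta_n=\min\Biggl(\sup_{\boldsymbol{x}\in[0,1]^s}f(\boldsymbol{x})-\inf_{\boldsymbol{x}\in[0,1]^s}f(\boldsymbol{x}),\ \frac{V_{\mathrm{HK}}(f)}{2^{m-t}}\sum_{i=0}^{s-1}\binom{m-t}{i}\Biggr)\in[0,\infty]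 $$ and $V_{\mathrm{HK}}(f)\in[0,\infty]$ is the total variation of $f$ in the sense of Hardy and Krause, i.e. the sum over nonempty $u\subseteq\{1,\dots,s\}$ of the Vitali variations over $[0,1]^u$ of $f$ with the coordinates outside $u$ fixed at $1$. -/

import Mathlib

open MeasureTheory ProbabilityTheory
open scoped ENNReal

noncomputable section

namespace MedianQMC

/-- The points `x 0, …, x (b ^ m - 1)` form a `(t, m, s)`-net in base `b`: they lie in `[0,1)^s`
and every elementary interval `∏ j, [c j / b ^ k j, (c j + 1) / b ^ k j)` with `∑ j, k j = m - t`
contains exactly `b ^ t` of them (counted with multiplicity). -/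
structure IsNet (b t m s : ℕ) (x : Fin (b ^ m) → Fin s → ℝ) : Prop where
  le : t ≤ m
  mem : ∀ i j, x i j ∈ Set.Ico (0 : ℝ) 1
  card : ∀ k c : Fin s → ℕ, ∑ j, k j = m - t → (∀ j, c j < b ^ k j) →
    Set.ncard {i | ∀ j, x i j ∈ Set.Ico ((c j : ℝ) / (b : ℝ) ^ k j)
      (((c j : ℝ) + 1) / (b : ℝ) ^ k j)} = b ^ t

/-- The vector of the `m` binary digits of `i`, least significant digit first. -/
def bits (m i : ℕ) : Fin m → ZMod 2 := fun l => if i.testBit l then 1 else 0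

/-- The points `a i` of the digital net with generator matrices `C j`: the binary digits of the
coordinate `a i j` are the entries of `C j * bits i` (mod 2). -/
def digitalPoint {s m : ℕ} (C : Fin s → Matrix (Fin m) (Fin m) (ZMod 2))
    (i : Fin (2 ^ m)) (j : Fin s) : ℝ :=
  ∑ l : Fin m, (((C j).mulVec (bits m i) l).val : ℝ) / 2 ^ ((l : ℕ) + 1)

/-- The matrices `C j` generate a digital `(t, m, s)`-net in base 2. -/
def IsDigitalNet {s m : ℕ} (t : ℕ) (C : Fin s → Matrix (Fin m) (Fin m) (ZMod 2)) : Prop :=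
  IsNet 2 t m s (digitalPoint C)

/-- Infinite precision scrambled points: the binary digits of the coordinate `x i j` are the
entries of `M j * C j * bits i + D j` (mod 2). Rows are numbered from `0`. -/
def scrambledPoint {s m : ℕ} (C : Fin s → Matrix (Fin m) (Fin m) (ZMod 2))
    (M : Fin s → Matrix ℕ (Fin m) (ZMod 2)) (D : Fin s → ℕ → ZMod 2)
    (i : Fin (2 ^ m)) (j : Fin s) : ℝ :=
  ∑' l : ℕ, (((M j * C j).mulVec (bits m i) l + D j l).val : ℝ) / 2 ^ (l + 1)

/-- The infinite precision estimate `(1 / n) ∑ i, f (x i)` with `n = 2 ^ m` scrambled points. -/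
def estimate {s m : ℕ} (f : (Fin s → ℝ) → ℝ) (C : Fin s → Matrix (Fin m) (Fin m) (ZMod 2))
    (M : Fin s → Matrix ℕ (Fin m) (ZMod 2)) (D : Fin s → ℕ → ZMod 2) : ℝ :=
  (1 / 2 ^ m) * ∑ i : Fin (2 ^ m), f (scrambledPoint C M D i)

/-- Positions of the random entries: those of the `M j` strictly below the diagonal, and all
entries of the `D j`. -/
abbrev RandomEntry (s m : ℕ) : Type :=
  {p : Fin s × ℕ × Fin m // (p.2.2 : ℕ) < p.2.1} ⊕ (Fin s × ℕ)

/-- The entry of `(M, D)` at a random position. -/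
def randomEntry {s m : ℕ} (M : Fin s → Matrix ℕ (Fin m) (ZMod 2)) (D : Fin s → ℕ → ZMod 2) :
    RandomEntry s m → ZMod 2
  | Sum.inl p => M p.1.1 p.1.2.1 p.1.2.2
  | Sum.inr q => D q.1 q.2

/-- Random linear scrambling with a digital shift, in infinite precision: each `M j` is lower
triangular with ones on the diagonal, and the entries below the diagonal together with all entries
of the `D j` are independent and uniform on `{0, 1}`. -/
structure IsRandomLinearScramble {s m : ℕ} {Ω : Type*} [MeasurableSpace Ω] (P : Measure Ω)
    (M : Ω → Fin s → Matrix ℕ (Fin m) (ZMod 2)) (D : Ω → Fin s → ℕ → ZMod 2) : Prop where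
  upper : ∀ ω j (l : ℕ) (k : Fin m), l < k → M ω j l k = 0
  diag : ∀ ω j (k : Fin m), M ω j k k = 1
  measurable : ∀ e, Measurable fun ω => randomEntry (M ω) (D ω) e
  uniform : ∀ e (b : ZMod 2), P {ω | randomEntry (M ω) (D ω) e = b} = 1 / 2
  indep : iIndepFun (fun e ω => randomEntry (M ω) (D ω) e) P

/-- The closed unit cube `[0,1]^s`. -/
def cube (s : ℕ) : Set (Fin s → ℝ) := Set.Icc 0 1

/-- `sup f - inf f` over the closed unit cube, as `sup_{x, y} (f x - f y)`; it is `∞` if `f` is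
unbounded there. -/
def oscillation {s : ℕ} (f : (Fin s → ℝ) → ℝ) : ℝ≥0∞ :=
  ⨆ x ∈ cube s, ⨆ y ∈ cube s, ENNReal.ofReal (f x - f y)

/-- The alternating sum of `f` over the vertices of the `u`-dimensional box
`∏ j ∈ u, [a j, b j]`, the coordinates outside `u` being fixed at `1`. -/
def increment {s : ℕ} (f : (Fin s → ℝ) → ℝ) (u : Finset (Fin s)) (a b : Fin s → ℝ) : ℝ :=
  ∑ v ∈ u.powerset, (-1 : ℝ) ^ (u \ v).card *
    f (fun j => if j ∈ v then b j else if j ∈ u then a j else 1)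

/-- The variation in the sense of Vitali over `[0,1]^u` of `f` with the coordinates outside `u`
fixed at `1`. The supremum is over grids `0 = g j 0 ≤ g j 1 ≤ … ≤ g j N = 1` (repeated knots only
add zero terms, so a common `N` is no restriction); the cells of the grid are indexed by
`i j < N` for `j ∈ u`, with `i j = 0` as a dummy value for `j ∉ u`. -/
def vitaliVariation {s : ℕ} (f : (Fin s → ℝ) → ℝ) (u : Finset (Fin s)) : ℝ≥0∞ :=
  ⨆ (N : ℕ) (g : {g : Fin s → ℕ → ℝ // ∀ j, Monotone (g j) ∧ g j 0 = 0 ∧ g j N = 1}),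
    ∑ i ∈ Fintype.piFinset (fun j => if j ∈ u then Finset.range N else {0}),
      ENNReal.ofReal |increment f u (fun j => g.1 j (i j)) (fun j => g.1 j (i j + 1))|

/-- The total variation in the sense of Hardy and Krause (anchored at `1`): the sum of the Vitali
variations over all nonempty sets of coordinates. -/
def hardyKrauseVariation {s : ℕ} (f : (Fin s → ℝ) → ℝ) : ℝ≥0∞ :=
  ∑ u : Finset (Fin s) with u.Nonempty, vitaliVariation f u

/-- The worst case error bound `Δ_n` for `(t, m, s)`-nets in base 2 (used for `t ≤ m`). -/
def errorBound (t m : ℕ) {s : ℕ} (f : (Fin s → ℝ) → ℝ) : ℝ≥0∞ :=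
  min (oscillation f)
    (hardyKrauseVariation f / 2 ^ (m - t) * ∑ i ∈ Finset.range s, ((m - t).choose i : ℝ≥0∞))

/-- The sample median of `2r - 1` numbers: the `r`-th smallest one. -/
def sampleMedian {r : ℕ} (hr : 0 < r) (x : Fin (2 * r - 1) → ℝ) : ℝ :=
  x (Tuple.sort x ⟨r - 1, by omega⟩)

end MedianQMC

end

/-!
If the median of `2 * r - 1` samples lies outside an interval, then so do at least `r` of the
samples. Take the interval of radius `√η` around `μ`, where `η` is `Pr(Aᶜ)` times the conditional
variance divided by `δ`. Since `Pr(A) ≤ δ`, Markov's inequality on `Aᶜ` shows that each sample lies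
outside with probability at most `2 δ`, and a union bound over the at most `4 ^ r` sets of `r`
samples gives probability at most `(8 δ) ^ r` for the median. On this event the squared error is at
most `Δ ^ 2`, the square of a bound that holds for every realization of the scrambling.

For that bound, solving the lower triangular system by forward substitution shows that a scrambled
net is still a net. Its local discrepancy is estimated by splitting the unit cube in half along an
active coordinate, where Pascal's rule produces the sum of binomial coefficients. For finite signed
point sets of total mass zero the Koksma–Hlawka inequality follows from Abel summation in every
coordinate. It compares the net with a stratified sample, and the integral is the average of such
samples over their offset, with cells as small as desired.
-/

namespace MedianQMC

section Median

variable {Ω : Type*} [MeasurableSpace Ω] {P : Measure Ω} {r : ℕ}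

lemma exists_card_eq_notMem_of_sampleMedian_notMem (hr : 0 < r) (x : Fin (2 * r - 1) → ℝ)
    {G : Set ℝ} (hG : G.OrdConnected) (hx : sampleMedian hr x ∉ G) :
    ∃ T : Finset (Fin (2 * r - 1)), T.card = r ∧ ∀ k ∈ T, x k ∈ Gᶜ := by
  have hmono : Monotone (x ∘ Tuple.sort x) := Tuple.monotone_sort x
  set middle : Fin (2 * r - 1) := ⟨r - 1, by omega⟩ with hmiddle
  by_contra! hT
  have exists_rank_mem : ∀ S : Finset (Fin (2 * r - 1)), S.card = r →
      ∃ k ∈ S, x (Tuple.sort x k) ∈ G := by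
    intro S hS
    obtain ⟨_, hk, hkG⟩ := hT (S.map (Tuple.sort x).toEmbedding) (by simpa using hS)
    obtain ⟨k, hkS, rfl⟩ := Finset.mem_map.1 hk
    exact ⟨k, hkS, not_not.1 hkG⟩
  obtain ⟨a, ha, haG⟩ :=
    exists_rank_mem (Finset.Iic middle) (by rw [Fin.card_Iic]; simp only [hmiddle]; omega)
  obtain ⟨b, hb, hbG⟩ :=
    exists_rank_mem (Finset.Ici middle) (by rw [Fin.card_Ici]; simp only [hmiddle]; omega)
  exact hx (hG.out haG hbG ⟨hmono (Finset.mem_Iic.1 ha), hmono (Finset.mem_Ici.1 hb)⟩)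

lemma measure_exists_card_eq_forall_mem_le {ι β : Type*} [Fintype ι] [MeasurableSpace β]
    {X : ι → Ω → β} (hX : iIndepFun X P) {B : Set β} (hB : MeasurableSet B) {p : ℝ≥0∞}
    (hp : ∀ i, P (X i ⁻¹' B) ≤ p) (n : ℕ) :
    P {ω | ∃ T : Finset ι, T.card = n ∧ ∀ i ∈ T, X i ω ∈ B}
      ≤ (Fintype.card ι).choose n * p ^ n := by
  have hunion : {ω | ∃ T : Finset ι, T.card = n ∧ ∀ i ∈ T, X i ω ∈ B}
      = ⋃ T ∈ Finset.powersetCard n Finset.univ, ⋂ i ∈ T, X i ⁻¹' B := by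
    ext ω
    simp
  rw [hunion]
  calc P (⋃ T ∈ Finset.powersetCard n Finset.univ, ⋂ i ∈ T, X i ⁻¹' B)
      ≤ ∑ T ∈ Finset.powersetCard n Finset.univ, P (⋂ i ∈ T, X i ⁻¹' B) :=
        measure_biUnion_finset_le _ _
    _ ≤ ∑ _T ∈ Finset.powersetCard n (Finset.univ : Finset ι), p ^ n := by
        refine Finset.sum_le_sum fun T hT => ?_
        rw [hX.measure_inter_preimage_eq_mul T fun _ _ => hB,
          ← (Finset.mem_powersetCard.1 hT).2]
        exact Finset.prod_le_pow_card _ _ _ fun i _ => hp i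
    _ = (Fintype.card ι).choose n * p ^ n := by simp

lemma choose_two_mul_sub_one_le_four_pow (r : ℕ) : (2 * r - 1).choose r ≤ 4 ^ r :=
  calc (2 * r - 1).choose r ≤ 2 ^ (2 * r - 1) := Nat.choose_le_two_pow _ _
    _ ≤ 2 ^ (2 * r) := Nat.pow_le_pow_right two_pos (Nat.sub_le _ _)
    _ = 4 ^ r := by rw [pow_mul]; norm_num

lemma measure_sampleMedian_notMem_le (hr : 0 < r) {X : Fin (2 * r - 1) → Ω → ℝ}
    (hX : iIndepFun X P) {G : Set ℝ} (hG : G.OrdConnected) (hGm : MeasurableSet G) {p : ℝ≥0∞}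
    (hp : ∀ k, P (X k ⁻¹' Gᶜ) ≤ p) :
    P {ω | sampleMedian hr (fun k => X k ω) ∉ G} ≤ (4 * p) ^ r :=
  calc P {ω | sampleMedian hr (fun k => X k ω) ∉ G}
      ≤ P {ω | ∃ T : Finset (Fin (2 * r - 1)), T.card = r ∧ ∀ k ∈ T, X k ω ∈ Gᶜ} :=
        measure_mono fun _ hω => exists_card_eq_notMem_of_sampleMedian_notMem hr _ hG hω
    _ ≤ (2 * r - 1).choose r * p ^ r := by
        simpa using measure_exists_card_eq_forall_mem_le hX hGm.compl hp r
    _ ≤ (4 * p) ^ r := by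
        rw [mul_pow]
        gcongr
        exact_mod_cast choose_two_mul_sub_one_le_four_pow r

lemma ordConnected_setOf_sub_sq_le (c : ℝ) (η : ℝ≥0∞) :
    {y : ℝ | ENNReal.ofReal ((y - c) ^ 2) ≤ η}.OrdConnected := by
  refine ⟨fun a ha b hb y hy => ?_⟩
  rcases le_total c y with h | h
  · exact (ENNReal.ofReal_le_ofReal (by nlinarith [hy.2])).trans hb
  · exact (ENNReal.ofReal_le_ofReal (by nlinarith [hy.1])).trans ha

lemma measurableSet_setOf_sub_sq_le (c : ℝ) (η : ℝ≥0∞) :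
    MeasurableSet {y : ℝ | ENNReal.ofReal ((y - c) ^ 2) ≤ η} :=
  measurableSet_le (by fun_prop) measurable_const

lemma measure_lintegral_div_lt_le {g : Ω → ℝ≥0∞} (hg : AEMeasurable g P) {δ : ℝ≥0∞}
    (hδ : δ ≠ 0) : P {ω | (∫⁻ ω', g ω' ∂P) / δ < g ω} ≤ δ := by
  set V := ∫⁻ ω, g ω ∂P
  rcases eq_or_ne δ ∞ with rfl | hδ_top
  · exact le_top
  rcases eq_or_ne V 0 with hV0 | hV0
  · have hg0 : g =ᵐ[P] 0 := (lintegral_eq_zero_iff' hg).1 hV0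
    refine (measure_mono_null (fun ω hω => ?_) hg0).trans_le zero_le
    exact (zero_le.trans_lt hω).ne'
  rcases eq_or_ne V ∞ with hV_top | hV_top
  · simp [hV_top, ENNReal.top_div_of_ne_top hδ_top]
  calc P {ω | V / δ < g ω} ≤ P {ω | V / δ ≤ g ω} := measure_mono fun ω (hω : V / δ < g ω) => hω.le
    _ ≤ V / (V / δ) := meas_ge_le_lintegral_div hg (ENNReal.div_ne_zero.2 ⟨hV0, hδ_top⟩)
        (ENNReal.div_ne_top hV_top hδ)
    _ = δ := ENNReal.div_div_cancel hV0 hV_top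

lemma measure_mul_evariance_cond [IsFiniteMeasure P] (Y : Ω → ℝ) {E : Set Ω} (hE : P E ≠ 0) :
    P E * evariance Y P[|E]
      = ∫⁻ ω in E, ENNReal.ofReal ((Y ω - ∫ ω', Y ω' ∂P[|E]) ^ 2) ∂P := by
  rw [evariance]
  generalize ∫ ω, Y ω ∂P[|E] = c
  rw [ProbabilityTheory.cond, lintegral_smul_measure, smul_eq_mul, ← mul_assoc,
    ENNReal.mul_inv_cancel hE (measure_ne_top P E), one_mul]
  refine lintegral_congr fun ω => ?_
  rw [← ofReal_norm, ← ENNReal.ofReal_pow (norm_nonneg _), Real.norm_eq_abs, sq_abs]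

lemma measure_evariance_cond_div_lt_sub_sq_le [IsFiniteMeasure P] {Y : Ω → ℝ}
    (hY : AEMeasurable Y P) {A : Set Ω} (hA0 : P Aᶜ ≠ 0) {δ : ℝ≥0∞} (hδ : δ ≠ 0)
    (hAδ : P A ≤ δ) :
    P {ω | P Aᶜ * evariance Y P[|Aᶜ] / δ < ENNReal.ofReal ((Y ω - ∫ ω', Y ω' ∂P[|Aᶜ]) ^ 2)}
      ≤ 2 * δ := by
  rw [measure_mul_evariance_cond Y hA0]
  generalize ∫ ω, Y ω ∂P[|Aᶜ] = c
  set B := {ω | (∫⁻ ω' in Aᶜ, ENNReal.ofReal ((Y ω' - c) ^ 2) ∂P) / δ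
    < ENNReal.ofReal ((Y ω - c) ^ 2)}
  have hmeas : AEMeasurable (fun ω => ENNReal.ofReal ((Y ω - c) ^ 2)) (P.restrict Aᶜ) := by
    have := hY.restrict (s := Aᶜ)
    fun_prop
  calc P B ≤ P (B ∩ A) + P (B ∩ Aᶜ) := measure_le_inter_add_sdiff P B A
    _ ≤ P A + P.restrict Aᶜ B :=
        add_le_add (measure_mono Set.inter_subset_right) (Measure.le_restrict_apply _ _)
    _ ≤ δ + δ := add_le_add hAδ (measure_lintegral_div_lt_le hmeas hδ)
    _ = 2 * δ := (two_mul δ).symm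

lemma lintegral_le_add_measure_lt_mul [IsProbabilityMeasure P] {g : Ω → ℝ≥0∞} {K : ℝ≥0∞}
    (hg : ∀ᵐ ω ∂P, g ω ≤ K) (η : ℝ≥0∞) : ∫⁻ ω, g ω ∂P ≤ η + P {ω | η < g ω} * K :=
  calc ∫⁻ ω, g ω ∂P ≤ ∫⁻ ω, (η + {ω | η < g ω}.indicator (fun _ => K) ω) ∂P := by
        refine lintegral_mono_ae ?_
        filter_upwards [hg] with ω hω
        by_cases h : η < g ω
        · rw [Set.indicator_of_mem (by exact h)]
          exact le_add_left hω
        · exact le_add_right (not_lt.1 h)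
    _ = η + ∫⁻ ω, {ω | η < g ω}.indicator (fun _ => K) ω ∂P := by
        rw [lintegral_add_left measurable_const, lintegral_const, measure_univ, mul_one]
    _ ≤ η + P {ω | η < g ω} * K := by
        rw [mul_comm]
        gcongr
        exact lintegral_indicator_const_le _ _

theorem lintegral_sampleMedian_sub_sq_le [IsProbabilityMeasure P] (hr : 0 < r) {Y : Ω → ℝ}
    {A : Set Ω} (hA0 : P Aᶜ ≠ 0) {δ : ℝ≥0∞} (hδ : δ ≠ 0) (hAδ : P A ≤ δ) {Δ : ℝ≥0∞}
    (hΔ : ∀ᵐ ω ∂P, ENNReal.ofReal |Y ω - ∫ ω', Y ω' ∂P[|Aᶜ]| ≤ Δ)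
    {Ω' : Type*} [MeasurableSpace Ω'] {P' : Measure Ω'} [IsProbabilityMeasure P']
    {X : Fin (2 * r - 1) → Ω' → ℝ} (hXindep : iIndepFun X P')
    (hXlaw : ∀ k, IdentDistrib (X k) Y P' P) :
    ∫⁻ ω, ENNReal.ofReal ((sampleMedian hr (fun k => X k ω) - ∫ ω', Y ω' ∂P[|Aᶜ]) ^ 2) ∂P'
      ≤ P Aᶜ * evariance Y P[|Aᶜ] / δ + (8 * δ) ^ r * Δ ^ 2 := by
  have hY : AEMeasurable Y P := (hXlaw ⟨0, by omega⟩).aemeasurable_snd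
  have hdeviation := measure_evariance_cond_div_lt_sub_sq_le hY hA0 hδ hAδ
  set c := ∫ ω, Y ω ∂P[|Aᶜ]
  set η := P Aᶜ * evariance Y P[|Aᶜ] / δ
  have hmedian_le : ∀ᵐ ω ∂P',
      ENNReal.ofReal ((sampleMedian hr (fun k => X k ω) - c) ^ 2) ≤ Δ ^ 2 := by
    have hX_le : ∀ᵐ ω ∂P', ∀ k, ENNReal.ofReal ((X k ω - c) ^ 2) ≤ Δ ^ 2 := by
      refine ae_all_iff.2 fun k => (hXlaw k).symm.ae_snd (measurableSet_setOf_sub_sq_le c _) ?_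
      filter_upwards [hΔ] with ω hω
      rw [← sq_abs, ENNReal.ofReal_pow (abs_nonneg _)]
      gcongr
    filter_upwards [hX_le] with ω hω using hω _
  have hmedian_lt : P' {ω | η < ENNReal.ofReal ((sampleMedian hr (fun k => X k ω) - c) ^ 2)}
      ≤ (4 * (2 * δ)) ^ r := by
    have hX_lt (k) : P' (X k ⁻¹' {y | ENNReal.ofReal ((y - c) ^ 2) ≤ η}ᶜ) ≤ 2 * δ := by
      rw [(hXlaw k).measure_mem_eq (measurableSet_setOf_sub_sq_le c η).compl]
      simpa [Set.preimage, Set.compl_ofPred] using hdeviation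
    simpa using measure_sampleMedian_notMem_le hr hXindep (ordConnected_setOf_sub_sq_le c η)
      (measurableSet_setOf_sub_sq_le c η) hX_lt
  calc _ ≤ η + P' {ω | η < ENNReal.ofReal ((sampleMedian hr (fun k => X k ω) - c) ^ 2)} * Δ ^ 2 :=
        lintegral_le_add_measure_lt_mul hmedian_le η
    _ ≤ η + (4 * (2 * δ)) ^ r * Δ ^ 2 := by gcongr
    _ = η + (8 * δ) ^ r * Δ ^ 2 := by rw [← mul_assoc]; norm_num

end Median

section BinaryExpansion

/-- The number `∑ l, e l / 2 ^ (l + 1)` with the binary digits `e`. The digits live in `ZMod 2`,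
which is `Fin 2` by definition. -/
noncomputable def binaryValue (e : ℕ → ZMod 2) : ℝ := Real.ofDigits (b := 2) e

lemma binaryValue_eq_tsum (e : ℕ → ZMod 2) :
    binaryValue e = ∑' l, ((e l).val : ℝ) / 2 ^ (l + 1) := rfl

lemma binaryValue_nonneg (e : ℕ → ZMod 2) : 0 ≤ binaryValue e := Real.ofDigits_nonneg _

lemma binaryValue_le_one (e : ℕ → ZMod 2) : binaryValue e ≤ 1 := Real.ofDigits_le_one _

lemma binaryValue_eq_head_add_tail (e : ℕ → ZMod 2) :
    binaryValue e = ((e 0).val + binaryValue fun l => e (l + 1)) / 2 := by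
  have h := Real.ofDigits_eq_sum_add_ofDigits (b := 2) e 1
  simp only [Finset.sum_range_one, Real.ofDigitsTerm, zero_add, pow_one] at h
  rw [binaryValue, h, add_div, div_eq_mul_inv, div_eq_inv_mul]
  rfl

lemma binaryValue_lt_one {e : ℕ → ZMod 2} {l : ℕ} (hl : e l = 0) : binaryValue e < 1 := by
  induction l generalizing e with
  | zero =>
    rw [binaryValue_eq_head_add_tail, hl, ZMod.val_zero, Nat.cast_zero]
    linarith [binaryValue_le_one fun l => e (l + 1)]
  | succ l ih =>
    have htail := ih (e := fun l => e (l + 1)) hl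
    have hhead : ((e 0).val : ℝ) ≤ 1 := by exact_mod_cast Nat.le_of_lt_succ (e 0).val_lt
    rw [binaryValue_eq_head_add_tail]
    linarith

/-- The natural number whose binary digits, most significant first, are the first `k` terms
of `e`. -/
def leadingDigits (e : ℕ → ZMod 2) : ℕ → ℕ
  | 0 => 0
  | k + 1 => 2 * leadingDigits e k + (e k).val

lemma leadingDigits_lt (e : ℕ → ZMod 2) (k : ℕ) : leadingDigits e k < 2 ^ k := by
  induction k with
  | zero => simp [leadingDigits]
  | succ k ih =>
    have := (e k).val_lt
    rw [leadingDigits, pow_succ]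
    omega

lemma leadingDigits_eq_iff (e e' : ℕ → ZMod 2) (k : ℕ) :
    leadingDigits e k = leadingDigits e' k ↔ ∀ l < k, e l = e' l := by
  induction k with
  | zero => simp [leadingDigits]
  | succ k ih =>
    have := (e k).val_lt
    have := (e' k).val_lt
    rw [Nat.forall_lt_succ_right, ← ih, leadingDigits, leadingDigits,
      ← (ZMod.val_injective 2).eq_iff]
    omega

lemma binaryValue_eq_leadingDigits_add (e : ℕ → ZMod 2) (k : ℕ) :
    binaryValue e = (leadingDigits e k + binaryValue fun l => e (k + l)) / 2 ^ k := by
  induction k with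
  | zero => simp [leadingDigits]
  | succ k ih =>
    rw [ih, binaryValue_eq_head_add_tail fun l => e (k + l), leadingDigits]
    push_cast
    simp only [add_zero, add_assoc, add_comm 1]
    field_simp
    ring

lemma binaryValue_mem_Ico_iff {e : ℕ → ZMod 2} {k l : ℕ} (hl : e l = 0) (hkl : k ≤ l)
    (c : ℕ) :
    binaryValue e ∈ Set.Ico ((c : ℝ) / 2 ^ k) (((c : ℝ) + 1) / 2 ^ k) ↔ leadingDigits e k = c := by
  have htail_nonneg := binaryValue_nonneg fun l => e (k + l)
  have htail_lt : binaryValue (fun l => e (k + l)) < 1 :=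
    binaryValue_lt_one (l := l - k) (by simpa only [Nat.add_sub_cancel' hkl] using hl)
  rw [Set.mem_Ico, binaryValue_eq_leadingDigits_add e k,
    div_le_div_iff_of_pos_right (by positivity), div_lt_div_iff_of_pos_right (by positivity)]
  constructor
  · rintro ⟨hle, hlt⟩
    have : c < leadingDigits e k + 1 := by
      exact_mod_cast hle.trans_lt (add_lt_add_right htail_lt _)
    have : leadingDigits e k < c + 1 := by
      exact_mod_cast (le_add_of_nonneg_right htail_nonneg).trans_lt hlt
    omega
  · rintro rfl
    constructor <;> linarith

end BinaryExpansion

section LocalDiscrepancy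

variable {ι κ : Type*} [Fintype κ] {I : Finset ι} {p : ι → κ → ℝ} {z : κ → ℝ}

/-- The part of `z` in the unit interval: `unitClamp z` is the length of `[0,1] ∩ [0,z)`. -/
noncomputable def unitClamp (z : ℝ) : ℝ := max 0 (min z 1)

/-- The number of the points `p i`, `i ∈ I`, in the box `∏ j, (-∞, z j)` minus its expected value,
the number of all points times the volume of the part of the box in the unit cube. -/
noncomputable def localDiscrepancy (I : Finset ι) (p : ι → κ → ℝ) (z : κ → ℝ) : ℝ :=
  (I.filter fun i => ∀ j, p i j < z j).card - I.card * ∏ j, unitClamp (z j)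

lemma unitClamp_nonneg (z : ℝ) : 0 ≤ unitClamp z := le_max_left _ _

lemma unitClamp_le_one (z : ℝ) : unitClamp z ≤ 1 := max_le zero_le_one (min_le_right _ _)

lemma unitClamp_of_nonpos {z : ℝ} (hz : z ≤ 0) : unitClamp z = 0 :=
  max_eq_left ((min_le_left _ _).trans hz)

lemma unitClamp_of_one_le {z : ℝ} (hz : 1 ≤ z) : unitClamp z = 1 := by
  rw [unitClamp, min_eq_right hz, max_eq_right zero_le_one]

lemma sum_zmod_two (F : ZMod 2 → ℝ) : ∑ b, F b = F 0 + F 1 := Fin.sum_univ_two F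

lemma sum_unitClamp_two_mul_sub (z : ℝ) :
    ∑ b : ZMod 2, unitClamp (2 * z - b.val) = 2 * unitClamp z := by
  rw [sum_zmod_two, ZMod.val_zero, ZMod.val_one, Nat.cast_zero, Nat.cast_one, sub_zero]
  simp only [unitClamp]
  grind

lemma localDiscrepancy_eq_card_sub {T : Finset ι} (hT : ∀ i, i ∈ T ↔ i ∈ I ∧ ∀ j, p i j < z j) :
    localDiscrepancy I p z = T.card - I.card * ∏ j, unitClamp (z j) := by
  rw [localDiscrepancy, Finset.ext fun i => Finset.mem_filter.trans (hT i).symm]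

lemma localDiscrepancy_of_nonpos (hp : ∀ i j, 0 ≤ p i j) {j : κ}
    (hz : z j ≤ 0) : localDiscrepancy I p z = 0 := by
  rw [localDiscrepancy, Finset.prod_eq_zero (Finset.mem_univ j) (unitClamp_of_nonpos hz),
    Finset.filter_false_of_mem fun i _ h => (h j).not_ge (hz.trans (hp i j))]
  simp

lemma localDiscrepancy_of_one_lt (hp : ∀ i j, p i j ≤ 1) {z : κ → ℝ}
    (hz : ∀ j, 1 < z j) : localDiscrepancy I p z = 0 := by
  rw [localDiscrepancy, Finset.prod_eq_one fun j _ => unitClamp_of_one_le (hz j).le,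
    Finset.filter_true_of_mem fun i _ j => (hp i j).trans_lt (hz j), mul_one, sub_self]

lemma localDiscrepancy_eq_zero_or_exists_mem_Ioo (hp : ∀ i j, p i j ∈ Set.Icc 0 1)
    (hz : ∀ j, z j ≠ 1) : localDiscrepancy I p z = 0 ∨ ∃ j, z j ∈ Set.Ioo 0 1 := by
  by_contra! h
  obtain ⟨hdisc, hz01⟩ := h
  have hpos (j) : 0 < z j :=
    not_le.1 fun hj => hdisc (localDiscrepancy_of_nonpos (fun i j => (hp i j).1) hj)
  exact hdisc <| localDiscrepancy_of_one_lt (fun i j => (hp i j).2) fun j =>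
    lt_of_le_of_ne (not_lt.1 fun hj => hz01 j ⟨hpos j, hj⟩) (hz j).symm

lemma abs_localDiscrepancy_le_card (p : ι → κ → ℝ) (z : κ → ℝ) :
    |localDiscrepancy I p z| ≤ I.card := by
  have hcount : ((I.filter fun i => ∀ j, p i j < z j).card : ℝ) ≤ I.card := by
    exact_mod_cast Finset.card_filter_le _ _
  have hprod : ∏ j, unitClamp (z j) ≤ 1 :=
    Finset.prod_le_one (fun _ _ => unitClamp_nonneg _) fun _ _ => unitClamp_le_one _
  rw [localDiscrepancy]
  refine abs_sub_le_of_nonneg_of_le (Nat.cast_nonneg _) hcount ?_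
    (mul_le_of_le_one_right (Nat.cast_nonneg _) hprod)
  exact mul_nonneg (Nat.cast_nonneg _) (Finset.prod_nonneg fun _ _ => unitClamp_nonneg _)

end LocalDiscrepancy

section DropDigit

variable {κ : Type*} [DecidableEq κ]

/-- The digit vector `x` with the first digit in the coordinate `j₀` removed. -/
def dropDigit (j₀ : κ) (x : κ → ℕ → ZMod 2) : κ → ℕ → ZMod 2 :=
  Function.update x j₀ fun l => x j₀ (l + 1)

lemma binaryValue_lt_iff_dropDigit (x : κ → ℕ → ZMod 2) (j₀ : κ) (z : κ → ℝ) :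
    (∀ j, binaryValue (x j) < z j) ↔ ∀ j, binaryValue (dropDigit j₀ x j)
      < Function.update z j₀ (2 * z j₀ - (x j₀ 0).val) j := by
  refine forall_congr' fun j => ?_
  rcases eq_or_ne j j₀ with rfl | hj
  · rw [dropDigit, Function.update_self, Function.update_self, binaryValue_eq_head_add_tail (x j)]
    constructor <;> intro <;> linarith
  · rw [dropDigit, Function.update_of_ne hj, Function.update_of_ne hj]

lemma eq_on_prefix_iff_dropDigit (x e : κ → ℕ → ZMod 2) (j₀ : κ) (k : κ → ℕ) (b : ZMod 2) :
    (∀ j, ∀ l < Function.update k j₀ (k j₀ + 1) j,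
      x j l = Function.update e j₀ (fun l => Nat.casesOn l b (e j₀)) j l) ↔
    x j₀ 0 = b ∧ ∀ j, ∀ l < k j, dropDigit j₀ x j l = e j l := by
  constructor
  · intro h
    refine ⟨by simpa using h j₀ 0 (by simp), fun j l hl => ?_⟩
    rcases eq_or_ne j j₀ with rfl | hj
    · simpa [dropDigit] using h j (l + 1) (by simpa using hl)
    · simpa [dropDigit, hj] using h j l (by simpa [hj] using hl)
  · rintro ⟨hhead, htail⟩ j l hl
    rcases eq_or_ne j j₀ with rfl | hj
    · rw [Function.update_self] at hl ⊢
      cases l with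
      | zero => exact hhead
      | succ l => simpa [dropDigit] using htail j l (by omega)
    · rw [Function.update_of_ne hj] at hl ⊢
      simpa [dropDigit, hj] using htail j l hl

end DropDigit

section DigitNet

variable {ι κ : Type*} [Fintype κ] {d t : ℕ} {I : Finset ι} {X : ι → κ → ℕ → ZMod 2}

/-- A `(t, d + t, s)`-net in base 2 in terms of digits: for all prefix lengths `k j` adding up
to `d`, exactly `2 ^ t` of the digit vectors `X i`, `i ∈ I`, have prescribed first `k j` digits in
each coordinate `j`. -/
def DigitNet (d t : ℕ) (I : Finset ι) (X : ι → κ → ℕ → ZMod 2) : Prop :=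
  ∀ (k : κ → ℕ) (e : κ → ℕ → ZMod 2), ∑ j, k j = d →
    (I.filter fun i => ∀ j, ∀ l < k j, X i j l = e j l).card = 2 ^ t

lemma DigitNet.filter_digit [DecidableEq κ] (h : DigitNet (d + 1) t I X) (j₀ : κ) (b : ZMod 2) :
    DigitNet d t (I.filter fun i => X i j₀ 0 = b) (fun i => dropDigit j₀ (X i)) := by
  intro k e hk
  rw [← h (Function.update k j₀ (k j₀ + 1))
    (Function.update e j₀ fun l => Nat.casesOn l b (e j₀)) ?_, Finset.filter_filter]
  · simp only [eq_on_prefix_iff_dropDigit]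
  · rw [Finset.sum_update_of_mem (Finset.mem_univ _), ← hk,
      ← Finset.add_sum_erase _ _ (Finset.mem_univ j₀), Finset.sdiff_singleton_eq_erase]
    ring

lemma DigitNet.card_eq [Nonempty κ] (h : DigitNet d t I X) : I.card = 2 ^ (d + t) := by
  classical
  induction d generalizing I X with
  | zero => simpa using h (fun _ => 0) (fun _ _ => 0) (by simp)
  | succ d ih =>
    obtain ⟨j₀⟩ := ‹Nonempty κ›
    rw [Finset.card_eq_sum_card_fiberwise (f := fun i => X i j₀ 0) (t := Finset.univ)
      (fun _ _ => Finset.mem_coe.2 (Finset.mem_univ _)),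
      Finset.sum_congr rfl fun b _ => ih (h.filter_digit j₀ b), Finset.sum_const, Finset.card_univ,
      ZMod.card, smul_eq_mul]
    ring

lemma localDiscrepancy_eq_sum_dropDigit [DecidableEq κ] (j₀ : κ)
    (hI : ∀ b, 2 * (I.filter fun i => X i j₀ 0 = b).card = I.card) (z : κ → ℝ) :
    localDiscrepancy I (fun i j => binaryValue (X i j)) z
      = ∑ b : ZMod 2, localDiscrepancy (I.filter fun i => X i j₀ 0 = b)
          (fun i j => binaryValue (dropDigit j₀ (X i) j))
          (Function.update z j₀ (2 * z j₀ - b.val)) := by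
  have hcount : (I.filter fun i => ∀ j, binaryValue (X i j) < z j).card
      = ∑ b : ZMod 2, ((I.filter fun i => X i j₀ 0 = b).filter fun i =>
          ∀ j, binaryValue (dropDigit j₀ (X i) j)
            < Function.update z j₀ (2 * z j₀ - b.val) j).card := by
    rw [Finset.card_eq_sum_card_fiberwise (f := fun i => X i j₀ 0) (t := Finset.univ)
      (fun _ _ => Finset.mem_coe.2 (Finset.mem_univ _))]
    refine Finset.sum_congr rfl fun b _ => congrArg Finset.card ?_
    rw [Finset.filter_comm]
    refine Finset.filter_congr fun i hi => ?_
    rw [binaryValue_lt_iff_dropDigit _ j₀, (Finset.mem_filter.1 hi).2]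
  have hvolume (b : ZMod 2) : ((I.filter fun i => X i j₀ 0 = b).card : ℝ)
      * ∏ j, unitClamp (Function.update z j₀ (2 * z j₀ - b.val) j)
      = unitClamp (2 * z j₀ - b.val)
        * (I.card / 2 * ∏ j ∈ Finset.univ.erase j₀, unitClamp (z j)) := by
    rw [← hI b, ← Finset.mul_prod_erase _ _ (Finset.mem_univ j₀), Function.update_self,
      Finset.prod_congr rfl fun j hj => by rw [Function.update_of_ne (Finset.ne_of_mem_erase hj)]]
    push_cast
    ring
  simp only [localDiscrepancy]
  rw [hcount, Finset.sum_sub_distrib, Nat.cast_sum, Finset.sum_congr rfl fun b _ => hvolume b,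
    ← Finset.sum_mul, sum_unitClamp_two_mul_sub, ← Finset.mul_prod_erase _ _ (Finset.mem_univ j₀)]
  ring

lemma sum_range_choose_succ (d c : ℕ) :
    ∑ i ∈ Finset.range (c + 1), (d + 1).choose i
      = ∑ i ∈ Finset.range c, d.choose i + ∑ i ∈ Finset.range (c + 1), d.choose i := by
  rw [Finset.sum_range_succ', Finset.sum_range_succ' (fun i => d.choose i)]
  simp only [Nat.choose_succ_succ, Finset.sum_add_distrib, Nat.choose_zero_right]
  ring

lemma DigitNet.localDiscrepancy_eq_sum [DecidableEq κ] (h : DigitNet (d + 1) t I X) (j₀ : κ)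
    (z : κ → ℝ) :
    localDiscrepancy I (fun i j => binaryValue (X i j)) z
      = ∑ b : ZMod 2, localDiscrepancy (I.filter fun i => X i j₀ 0 = b)
          (fun i j => binaryValue (dropDigit j₀ (X i) j))
          (Function.update z j₀ (2 * z j₀ - b.val)) := by
  have : Nonempty κ := ⟨j₀⟩
  refine localDiscrepancy_eq_sum_dropDigit j₀ (fun b => ?_) z
  rw [h.card_eq, (h.filter_digit j₀ b).card_eq]
  ring

lemma card_filter_update_lt_one [DecidableEq κ] {z : κ → ℝ} {j₀ : κ} (hj₀ : z j₀ < 1) {a : ℝ}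
    (ha : a < 1) :
    (Finset.univ.filter fun j => Function.update z j₀ a j < 1).card
      = (Finset.univ.filter fun j => z j < 1).card := by
  congr 1
  refine Finset.filter_congr fun j _ => ?_
  rcases eq_or_ne j j₀ with rfl | hj
  · simp [ha, hj₀]
  · rw [Function.update_of_ne hj]

lemma card_filter_update_one_le_add_one [DecidableEq κ] {z : κ → ℝ} {j₀ : κ} (hj₀ : z j₀ < 1)
    {a : ℝ} (ha : 1 ≤ a) :
    (Finset.univ.filter fun j => Function.update z j₀ a j < 1).card + 1
      = (Finset.univ.filter fun j => z j < 1).card := by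
  rw [← Finset.card_erase_add_one (s := Finset.univ.filter fun j => z j < 1) (a := j₀) (by simpa)]
  congr 2
  ext j
  rcases eq_or_ne j j₀ with rfl | hj
  · simp [ha]
  · simp [hj]

lemma DigitNet.abs_localDiscrepancy_le_of_zero (h : DigitNet 0 t I X) {z : κ → ℝ}
    (hz : ∀ j, z j ≠ 1) :
    |localDiscrepancy I (fun i j => binaryValue (X i j)) z|
      ≤ 2 ^ t * ∑ i ∈ Finset.range (Finset.univ.filter fun j => z j < 1).card,
          (Nat.choose 0 i : ℝ) := by
  obtain hzero | ⟨j₀, hj₀⟩ := localDiscrepancy_eq_zero_or_exists_mem_Ioo (I := I)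
    (fun i j => ⟨binaryValue_nonneg (X i j), binaryValue_le_one _⟩) hz
  · rw [hzero, abs_zero]
    positivity
  have : Nonempty κ := ⟨j₀⟩
  have hactive : 0 < (Finset.univ.filter fun j => z j < 1).card :=
    Finset.card_pos.2 ⟨j₀, by simpa using hj₀.2⟩
  refine (abs_localDiscrepancy_le_card _ _).trans ?_
  rw [h.card_eq, zero_add, Nat.cast_pow, Nat.cast_ofNat]
  refine le_mul_of_one_le_right (by positivity) ?_
  simpa using Finset.single_le_sum (f := fun i => (Nat.choose 0 i : ℝ))
    (fun i _ => Nat.cast_nonneg _) (Finset.mem_range.2 hactive)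

lemma irrational_update_two_mul_sub {κ : Type*} [DecidableEq κ] {z : κ → ℝ}
    (hz : ∀ j, Irrational (z j)) (j₀ : κ) (n : ℕ) (j : κ) :
    Irrational (Function.update z j₀ (2 * z j₀ - n) j) := by
  rcases eq_or_ne j j₀ with rfl | hj
  · rw [Function.update_self]
    exact ((hz j).natCast_mul two_ne_zero).sub_natCast n
  · rw [Function.update_of_ne hj]
    exact hz j

/-- Split off the first digit of an active coordinate `j₀`, one with `0 < z j₀ < 1`: if
`z j₀ < 1 / 2`, then only the points with first digit `0` matter, and otherwise `j₀` is no longer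
active for these. -/
theorem DigitNet.abs_localDiscrepancy_le (h : DigitNet d t I X) {z : κ → ℝ}
    (hz : ∀ j, Irrational (z j)) :
    |localDiscrepancy I (fun i j => binaryValue (X i j)) z|
      ≤ 2 ^ t * ∑ i ∈ Finset.range (Finset.univ.filter fun j => z j < 1).card,
          (d.choose i : ℝ) := by
  classical
  induction d generalizing I X z with
  | zero => exact h.abs_localDiscrepancy_le_of_zero fun j => (hz j).ne_one
  | succ d ih =>
    obtain hzero | ⟨j₀, hj₀⟩ := localDiscrepancy_eq_zero_or_exists_mem_Ioo (I := I)
      (fun i j => ⟨binaryValue_nonneg (X i j), binaryValue_le_one _⟩) fun j => (hz j).ne_one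
    · rw [hzero, abs_zero]
      positivity
    have ih_half (b : ZMod 2) :=
      ih (h.filter_digit j₀ b) (irrational_update_two_mul_sub hz j₀ b.val)
    rw [h.localDiscrepancy_eq_sum j₀ z, sum_zmod_two]
    have ih₀ := ih_half 0
    have ih₁ := ih_half 1
    rw [ZMod.val_zero, Nat.cast_zero, sub_zero] at ih₀ ⊢
    rw [ZMod.val_one, Nat.cast_one] at ih₁ ⊢
    rcases lt_or_ge (z j₀) (1 / 2) with hlt | hge
    · rw [card_filter_update_lt_one hj₀.2 (by linarith)] at ih₀
      rw [localDiscrepancy_of_nonpos (z := Function.update z j₀ (2 * z j₀ - 1)) (j := j₀)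
        (fun _ _ => binaryValue_nonneg _) (by rw [Function.update_self]; linarith), add_zero]
      refine ih₀.trans ?_
      gcongr
      exact Nat.le_succ d
    · rw [card_filter_update_lt_one hj₀.2 (by linarith [hj₀.2]),
        ← card_filter_update_one_le_add_one hj₀.2 (a := 2 * z j₀) (by linarith)] at ih₁
      rw [← card_filter_update_one_le_add_one hj₀.2 (a := 2 * z j₀) (by linarith)]
      refine (abs_add_le _ _).trans ((add_le_add ih₀ ih₁).trans_eq ?_)
      rw [← mul_add]
      exact_mod_cast congrArg (2 ^ t * ·) (sum_range_choose_succ d _).symm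

end DigitNet

section Scrambling

/-- Forward substitution in a unit lower triangular system. -/
lemma exists_forall_lt_eq_iff_of_triangular {R : Type*} [AddGroup R] (F : ℕ → (ℕ → R) → R)
    (hF : ∀ l v w, (∀ q < l, v q = w q) → F l v = F l w) (e : ℕ → R) (k : ℕ) :
    ∃ e' : ℕ → R, ∀ v : ℕ → R, (∀ l < k, v l + F l v = e l) ↔ ∀ l < k, v l = e' l := by
  induction k with
  | zero => exact ⟨e, by simp⟩
  | succ k ih =>
    obtain ⟨e', he'⟩ := ih
    refine ⟨Function.update e' k (e k - F k e'), fun v => ?_⟩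
    have hupdate : (∀ l < k, v l = Function.update e' k (e k - F k e') l) ↔ ∀ l < k, v l = e' l :=
      forall₂_congr fun l hl => by rw [Function.update_of_ne hl.ne]
    rw [Nat.forall_lt_succ_right, Nat.forall_lt_succ_right, he', hupdate, Function.update_self]
    refine and_congr_right fun hv => ?_
    rw [hF k v e' hv, eq_sub_iff_add_eq]

lemma DigitNet.of_triangular {ι κ : Type*} [Fintype κ] {d t : ℕ} {I : Finset ι}
    {X Y : ι → κ → ℕ → ZMod 2} (hX : DigitNet d t I X) (F : κ → ℕ → (ℕ → ZMod 2) → ZMod 2)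
    (hF : ∀ j l v w, (∀ q < l, v q = w q) → F j l v = F j l w)
    (hY : ∀ i j, ∀ l < d, Y i j l = X i j l + F j l (X i j)) : DigitNet d t I Y := by
  intro k e hk
  have hkd (j) : k j ≤ d := hk ▸ Finset.single_le_sum (fun _ _ => Nat.zero_le _) (Finset.mem_univ j)
  choose e' he' using fun j => exists_forall_lt_eq_iff_of_triangular (F j) (hF j) (e j) (k j)
  rw [← hX k e' hk]
  refine congrArg Finset.card (Finset.filter_congr fun i _ => forall_congr' fun j => ?_)
  rw [← he']
  exact forall₂_congr fun l hl => by rw [hY i j l (hl.trans_le (hkd j))]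

/-- The matrix `L`, with rows indexed by all natural numbers, is lower triangular with ones on the
diagonal. -/
structure IsUnitLowerTriangular {R : Type*} [Zero R] [One R] {m : ℕ} (L : Matrix ℕ (Fin m) R) :
    Prop where
  upper : ∀ (l : ℕ) (k : Fin m), l < k → L l k = 0
  diag : ∀ k : Fin m, L k k = 1

lemma IsUnitLowerTriangular.mulVec_apply {R : Type*} [NonAssocSemiring R] {m : ℕ}
    {L : Matrix ℕ (Fin m) R} (hL : IsUnitLowerTriangular L) (v : Fin m → R) (k : Fin m) :
    L.mulVec v k = v k + ∑ q : Fin m, if q < k then L k q * v q else 0 := by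
  have hv : v k = ∑ q : Fin m, if q = k then v q else 0 := by simp
  rw [hv, ← Finset.sum_add_distrib, Matrix.mulVec, dotProduct]
  refine Finset.sum_congr rfl fun q _ => ?_
  rcases lt_trichotomy q k with h | rfl | h
  · simp [h, h.ne]
  · simp [hL.diag]
  · simp [hL.upper k q h, h.ne', h.not_gt]

variable {s m t : ℕ} (C : Fin s → Matrix (Fin m) (Fin m) (ZMod 2))
  (M : Fin s → Matrix ℕ (Fin m) (ZMod 2)) (D : Fin s → ℕ → ZMod 2)

/-- The binary digits of the points of a digital net, padded with zeros. -/
def netDigit (i : Fin (2 ^ m)) (j : Fin s) (l : ℕ) : ZMod 2 :=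
  if h : l < m then (C j).mulVec (bits m i) ⟨l, h⟩ else 0

/-- The binary digits of the scrambled points. -/
def scrambledDigit (i : Fin (2 ^ m)) (j : Fin s) (l : ℕ) : ZMod 2 :=
  (M j * C j).mulVec (bits m i) l + D j l

lemma digitalPoint_eq_binaryValue (i : Fin (2 ^ m)) (j : Fin s) :
    digitalPoint C i j = binaryValue (netDigit C i j) := by
  rw [binaryValue_eq_tsum, tsum_eq_sum (s := Finset.range m), Finset.sum_range]
  · simp [netDigit, digitalPoint]
  · intro l hl
    simp [netDigit, Finset.mem_range.not.1 hl]

lemma scrambledPoint_eq_binaryValue :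
    scrambledPoint C M D = fun i j => binaryValue (scrambledDigit C M D i j) := rfl

variable {C M}

lemma scrambledDigit_eq_netDigit_add (hM : ∀ j, IsUnitLowerTriangular (M j)) (i : Fin (2 ^ m))
    (j : Fin s) {l : ℕ} (hl : l < m) :
    scrambledDigit C M D i j l = netDigit C i j l
      + ((∑ q : Fin m, if (q : ℕ) < l then M j l q * netDigit C i j q else 0) + D j l) := by
  rw [scrambledDigit, ← Matrix.mulVec_mulVec,
    (hM j).mulVec_apply ((C j).mulVec (bits m i)) ⟨l, hl⟩, add_assoc]
  simp [netDigit, hl, Fin.lt_def]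

lemma IsDigitalNet.digitNet (hC : IsDigitalNet t C) :
    DigitNet (m - t) t Finset.univ (netDigit C) := by
  intro k e hk
  rw [← hC.card k (fun j => leadingDigits (e j) (k j)) hk fun j => leadingDigits_lt _ _,
    ← Set.ncard_coe_finset]
  congr 1
  ext i
  simp only [Finset.coe_filter, Finset.mem_univ, true_and, Set.mem_ofPred_eq, Nat.cast_ofNat,
    digitalPoint_eq_binaryValue]
  refine forall_congr' fun j => ?_
  rw [binaryValue_mem_Ico_iff (l := m + k j) (by simp [netDigit]) (Nat.le_add_left _ _),
    leadingDigits_eq_iff]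

lemma IsDigitalNet.digitNet_scrambledDigit (hC : IsDigitalNet t C)
    (hM : ∀ j, IsUnitLowerTriangular (M j)) :
    DigitNet (m - t) t Finset.univ (scrambledDigit C M D) := by
  refine hC.digitNet.of_triangular
    (fun j l v => (∑ q : Fin m, if (q : ℕ) < l then M j l q * v q else 0) + D j l)
    (fun j l v w hvw => ?_)
    fun i j l hl => scrambledDigit_eq_netDigit_add D hM i j (hl.trans_le (Nat.sub_le m t))
  congr 1
  refine Finset.sum_congr rfl fun q _ => ?_
  split_ifs with hq
  · rw [hvw q hq]
  · rfl

end Scrambling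

section KoksmaHlawka

variable {s N : ℕ} {g : ℕ → ℝ}

lemma increment_prod (h : Fin s → ℝ → ℝ) (u : Finset (Fin s)) (a b : Fin s → ℝ) :
    increment (fun x => ∏ j, h j (x j)) u a b
      = (∏ j ∈ u, (h j (b j) - h j (a j))) * ∏ j ∈ uᶜ, h j 1 := by
  simp only [sub_eq_add_neg]
  rw [Finset.prod_add, Finset.sum_mul, increment]
  refine Finset.sum_congr rfl fun v hv => ?_
  have hvu := Finset.mem_powerset.1 hv
  set x : Fin s → ℝ := fun j => if j ∈ v then b j else if j ∈ u then a j else 1 with hx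
  have hlower : ∏ j ∈ u \ v, h j (x j) = ∏ j ∈ u \ v, h j (a j) :=
    Finset.prod_congr rfl fun j hj => by simp [hx, Finset.mem_sdiff.1 hj]
  have hupper : ∏ j ∈ v, h j (x j) = ∏ j ∈ v, h j (b j) :=
    Finset.prod_congr rfl fun j hj => by simp [hx, hj]
  have houtside : ∏ j ∈ uᶜ, h j (x j) = ∏ j ∈ uᶜ, h j 1 :=
    Finset.prod_congr rfl fun j hj => by
      have hju := Finset.mem_compl.1 hj
      have hjv : j ∉ v := fun h => hju (hvu h)
      simp [hx, hju, hjv]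
  rw [Finset.prod_neg, ← Finset.prod_mul_prod_compl u, ← Finset.prod_sdiff hvu, hlower, hupper,
    houtside]
  ring

lemma increment_sum {κ : Type*} (T : Finset κ) (c : κ → ℝ) (F : κ → (Fin s → ℝ) → ℝ)
    (u : Finset (Fin s)) (a b : Fin s → ℝ) :
    increment (fun x => ∑ q ∈ T, c q * F q x) u a b = ∑ q ∈ T, c q * increment (F q) u a b := by
  simp only [increment, Finset.mul_sum]
  rw [Finset.sum_comm]
  exact Finset.sum_congr rfl fun _ _ => Finset.sum_congr rfl fun _ _ => mul_left_comm _ _ _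

lemma increment_congr {f f' : (Fin s → ℝ) → ℝ} {S : Set ℝ}
    (hff' : Set.EqOn f f' (Set.univ.pi fun _ => S)) (h1 : 1 ∈ S) {u : Finset (Fin s)}
    {a b : Fin s → ℝ} (ha : ∀ j ∈ u, a j ∈ S) (hb : ∀ j ∈ u, b j ∈ S) :
    increment f u a b = increment f' u a b := by
  refine Finset.sum_congr rfl fun v hv => ?_
  rw [hff' fun j _ => ?_]
  split_ifs with hjv hju
  · exact hb j (Finset.mem_powerset.1 hv hjv)
  · exact ha j hju
  · exact h1

/-- The cells of a grid with `N` intervals in each of the coordinates `j ∈ u`, indexed as in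
`vitaliVariation`. -/
def gridCells (N : ℕ) (u : Finset (Fin s)) : Finset (Fin s → ℕ) :=
  Fintype.piFinset fun j => if j ∈ u then Finset.range N else {0}

lemma lt_of_mem_gridCells {u : Finset (Fin s)} {c : Fin s → ℕ} (hc : c ∈ gridCells N u)
    {j : Fin s} (hj : j ∈ u) : c j < N := by
  simpa [hj] using Fintype.mem_piFinset.1 hc j

lemma prod_sum_range_eq_sum_gridCells (u : Finset (Fin s)) (F : Fin s → ℕ → ℝ) :
    ∏ j ∈ u, ∑ k ∈ Finset.range N, F j k = ∑ c ∈ gridCells N u, ∏ j ∈ u, F j (c j) := by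
  have hextend (c : Fin s → ℕ) : ∏ j ∈ u, F j (c j) = ∏ j, if j ∈ u then F j (c j) else 1 := by
    rw [Finset.prod_ite_mem, Finset.univ_inter]
  simp only [hextend]
  rw [gridCells, ← Finset.prod_univ_sum _ (fun j k => if j ∈ u then F j k else 1),
    ← Finset.univ_inter u, ← Finset.prod_ite_mem]
  refine Finset.prod_congr rfl fun j _ => ?_
  by_cases hj : j ∈ u <;> simp [hj]

lemma apply_eq_sub_sum_range_increments (h : ℝ → ℝ) (hg : StrictMonoOn g (Set.Iic N)) {y : ℝ}
    (hy : y ∈ g '' Set.Iic N) :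
    h y = h (g N) - ∑ k ∈ Finset.range N,
      (if y ≤ g k then 1 else 0) * (h (g (k + 1)) - h (g k)) := by
  obtain ⟨a, ha, rfl⟩ := hy
  have hIco : Finset.Ico a N = (Finset.range N).filter fun k => g a ≤ g k := by
    ext k
    rw [Finset.mem_filter, Finset.mem_range, Finset.mem_Ico, and_comm]
    exact and_congr_right fun hk => (hg.le_iff_le ha (Set.mem_Iic.2 hk.le)).symm
  simp only [ite_mul, one_mul, zero_mul]
  rw [← Finset.sum_filter, ← hIco, Finset.sum_Ico_sub (fun k => h (g k)) ha, sub_sub_cancel]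

/-- The expansion of `f` at the point `x` into increments over the cells of the grid with knots
`g 0, …, g N` that lie above `x`. -/
noncomputable def gridExpansion (g : ℕ → ℝ) (N : ℕ) (f : (Fin s → ℝ) → ℝ) (x : Fin s → ℝ) : ℝ :=
  ∑ u : Finset (Fin s), (-1) ^ u.card * ∑ c ∈ gridCells N u,
    (if ∀ j ∈ u, x j ≤ g (c j) then 1 else 0) *
      increment f u (fun j => g (c j)) (fun j => g (c j + 1))

lemma gridExpansion_sum {κ : Type*} (T : Finset κ) (a : κ → ℝ) (F : κ → (Fin s → ℝ) → ℝ)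
    (x : Fin s → ℝ) :
    gridExpansion g N (fun x => ∑ q ∈ T, a q * F q x) x
      = ∑ q ∈ T, a q * gridExpansion g N (F q) x := by
  simp only [gridExpansion, increment_sum, Finset.mul_sum]
  rw [Finset.sum_comm]
  refine Finset.sum_congr rfl fun u _ => ?_
  rw [Finset.sum_comm]
  refine Finset.sum_congr rfl fun c _ => Finset.sum_congr rfl fun q _ => ?_
  ring

lemma gridExpansion_congr {f f' : (Fin s → ℝ) → ℝ}
    (hff' : Set.EqOn f f' (Set.univ.pi fun _ => g '' Set.Iic N)) (hN : g N = 1) (x : Fin s → ℝ) :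
    gridExpansion g N f x = gridExpansion g N f' x := by
  refine Finset.sum_congr rfl fun u _ => ?_
  congr 1
  refine Finset.sum_congr rfl fun c hc => ?_
  rw [increment_congr hff' ⟨N, Set.self_mem_Iic, hN⟩
    (fun j hj => Set.mem_image_of_mem g (Set.mem_Iic.2 (lt_of_mem_gridCells hc hj).le))
    fun j hj => Set.mem_image_of_mem g (Set.mem_Iic.2 (lt_of_mem_gridCells hc hj))]

lemma gridExpansion_prod (hg : StrictMonoOn g (Set.Iic N)) (hN : g N = 1)
    (h : Fin s → ℝ → ℝ) {x : Fin s → ℝ} (hx : ∀ j, x j ∈ g '' Set.Iic N) :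
    gridExpansion g N (fun x => ∏ j, h j (x j)) x = ∏ j, h j (x j) := by
  have hcoord (j) := apply_eq_sub_sum_range_increments (h j) hg (hx j)
  rw [Finset.prod_congr rfl fun j _ => (hcoord j).trans (sub_eq_neg_add _ _), Finset.prod_add,
    Finset.powerset_univ]
  refine Finset.sum_congr rfl fun u _ => ?_
  rw [Finset.prod_neg, prod_sum_range_eq_sum_gridCells, mul_assoc, Finset.sum_mul]
  congr 1
  refine Finset.sum_congr rfl fun c _ => ?_
  rw [increment_prod, Finset.prod_mul_distrib, Finset.prod_boole, mul_assoc,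
    ← Finset.compl_eq_univ_sdiff, hN]
  congr!

lemma sum_piFinset_mul_prod_ite_eq (f : (Fin s → ℝ) → ℝ) {S : Finset ℝ} {x : Fin s → ℝ}
    (hx : ∀ j, x j ∈ S) :
    ∑ q ∈ Fintype.piFinset (fun _ => S), f q * ∏ j, (if x j = q j then 1 else 0) = f x := by
  have hprod (q : Fin s → ℝ) :
      ∏ j, (if x j = q j then 1 else 0) = if x = q then (1 : ℝ) else 0 := by
    rw [Finset.prod_boole]
    simp [funext_iff]
  simp only [hprod, mul_ite, mul_one, mul_zero]
  rw [Finset.sum_ite_eq, if_pos (Fintype.mem_piFinset.2 hx)]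

/-- The expansion is linear in `f`, and on the grid `f` is a linear combination of products of
functions of one variable. -/
lemma gridExpansion_eq (hg : StrictMonoOn g (Set.Iic N)) (hN : g N = 1) (f : (Fin s → ℝ) → ℝ)
    {x : Fin s → ℝ} (hx : ∀ j, x j ∈ g '' Set.Iic N) : gridExpansion g N f x = f x := by
  classical
  set S : Finset ℝ := (Finset.Iic N).image g with hS
  have hmem (y) : y ∈ S ↔ y ∈ g '' Set.Iic N := by simp [hS]
  have hf : Set.EqOn f (fun y => ∑ q ∈ Fintype.piFinset (fun _ => S),
      f q * ∏ j, (if y j = q j then 1 else 0)) (Set.univ.pi fun _ => g '' Set.Iic N) := fun y hy =>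
    (sum_piFinset_mul_prod_ite_eq f fun j => (hmem _).2 (hy j (Set.mem_univ j))).symm
  rw [gridExpansion_congr hf hN, gridExpansion_sum, hf fun j _ => hx j]
  refine Finset.sum_congr rfl fun q _ => ?_
  rw [gridExpansion_prod hg hN (fun j y => if y = q j then 1 else 0) hx]

lemma exists_monotone_image_Iic_eq {α : Type*} [LinearOrder α] {S : Finset α} (hS : S.Nonempty) :
    ∃ (N : ℕ) (g : ℕ → α), Monotone g ∧ StrictMonoOn g (Set.Iic N) ∧ g '' Set.Iic N = S := by
  obtain ⟨N, hN⟩ := Nat.exists_eq_succ_of_ne_zero hS.card_ne_zero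
  set enum := S.orderEmbOfFin hN
  refine ⟨N, fun k => enum ⟨min k N, by omega⟩, fun a b hab => enum.monotone ?_,
    fun a ha b hb hab => enum.strictMono ?_, ?_⟩
  · exact Fin.mk_le_mk.2 (min_le_min_right N hab)
  · rwa [Fin.mk_lt_mk, min_eq_left ha, min_eq_left hb]
  · rw [← Finset.range_orderEmbOfFin S hN]
    ext y
    constructor
    · rintro ⟨k, -, rfl⟩
      exact ⟨_, rfl⟩
    · rintro ⟨k, rfl⟩
      refine ⟨k, Nat.le_of_lt_succ k.2, congrArg enum (Fin.ext (min_eq_left ?_))⟩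
      exact Nat.le_of_lt_succ k.2

lemma exists_grid (S : Finset ℝ) (hS : ∀ y ∈ S, y ∈ Set.Icc (0 : ℝ) 1) :
    ∃ (N : ℕ) (g : ℕ → ℝ), Monotone g ∧ StrictMonoOn g (Set.Iic N) ∧ g 0 = 0 ∧ g N = 1 ∧
      ∀ y ∈ S, y ∈ g '' Set.Iic N := by
  classical
  obtain ⟨N, g, hmono, hg, hrange⟩ :=
    exists_monotone_image_Iic_eq (Finset.insert_nonempty (0 : ℝ) (insert 1 S))
  have hIcc (k) (hk : k ≤ N) : g k ∈ Set.Icc (0 : ℝ) 1 := by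
    have : g k ∈ insert 0 (insert 1 S) :=
      Finset.mem_coe.1 (hrange ▸ Set.mem_image_of_mem g (Set.mem_Iic.2 hk))
    simp only [Finset.mem_insert] at this
    rcases this with h | h | h
    · simp [h]
    · simp [h]
    · exact hS _ h
  have hmem {y} (hy : y ∈ insert 0 (insert 1 S)) : y ∈ g '' Set.Iic N := hrange ▸ hy
  obtain ⟨a, -, ha⟩ := hmem (y := 0) (by simp)
  obtain ⟨b, hb, hb1⟩ := hmem (y := 1) (by simp)
  refine ⟨N, g, hmono, hg, ?_, ?_, fun y hy => hmem (by simp [hy])⟩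
  · exact le_antisymm (ha ▸ hmono (Nat.zero_le a)) (hIcc 0 (Nat.zero_le N)).1
  · exact le_antisymm (hIcc N le_rfl).2 (hb1 ▸ hmono hb)

/-- Replacing knots by nearby irrational numbers does not change which grid points lie below. -/
lemma exists_irrational_forall_lt_iff (hmono : Monotone g) (hg : StrictMonoOn g (Set.Iic N))
    (hN : g N = 1) {u : Finset (Fin s)} {c : Fin s → ℕ} (hc : c ∈ gridCells N u) :
    ∃ z : Fin s → ℝ, (∀ j, Irrational (z j)) ∧ ∀ x : Fin s → ℝ, (∀ j, x j ∈ g '' Set.Iic N) →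
      ((∀ j, x j < z j) ↔ ∀ j ∈ u, x j ≤ g (c j)) := by
  have hcoord (j) : ∃ z : ℝ, Irrational z ∧
      ∀ y ∈ g '' Set.Iic N, (y < z ↔ (j ∈ u → y ≤ g (c j))) := by
    by_cases hj : j ∈ u
    · have hcN := lt_of_mem_gridCells hc hj
      obtain ⟨z, hz, hlt, hgt⟩ := exists_irrational_btwn
        (hg (Set.mem_Iic.2 hcN.le) (Set.mem_Iic.2 hcN) (Nat.lt_succ_self (c j)))
      refine ⟨z, hz, ?_⟩
      rintro _ ⟨a, -, rfl⟩
      refine ⟨fun h _ => hmono (Nat.le_of_lt_succ ?_), fun h => (h hj).trans_lt hlt⟩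
      exact hmono.reflect_lt (h.trans hgt)
    · obtain ⟨z, hz, h1z, -⟩ := exists_irrational_btwn (one_lt_two : (1 : ℝ) < 2)
      refine ⟨z, hz, ?_⟩
      rintro _ ⟨a, ha, rfl⟩
      exact iff_of_true ((hN ▸ hmono ha).trans_lt h1z) fun h => absurd h hj
  choose z hz hzc using hcoord
  exact ⟨z, hz, fun x hx => forall_congr' fun j => hzc j _ (hx j)⟩

lemma sum_ofReal_abs_increment_le_vitaliVariation (f : (Fin s → ℝ) → ℝ) (hmono : Monotone g)
    (h0 : g 0 = 0) (hN : g N = 1) (u : Finset (Fin s)) :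
    ∑ c ∈ gridCells N u,
      ENNReal.ofReal |increment f u (fun j => g (c j)) (fun j => g (c j + 1))|
        ≤ vitaliVariation f u :=
  le_iSup₂_of_le N ⟨fun _ => g, fun _ => ⟨hmono, h0, hN⟩⟩ le_rfl

lemma sum_mul_gridExpansion {ι : Type*} [Fintype ι] (f : (Fin s → ℝ) → ℝ) (w : ι → ℝ)
    (p : ι → Fin s → ℝ) (hw : ∑ i, w i = 0) :
    ∑ i, w i * gridExpansion g N f (p i) = ∑ u : Finset (Fin s) with u.Nonempty, (-1) ^ u.card *
      ∑ c ∈ gridCells N u, (∑ i, if ∀ j ∈ u, p i j ≤ g (c j) then w i else 0) *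
        increment f u (fun j => g (c j)) (fun j => g (c j + 1)) := by
  rw [Finset.sum_filter_of_ne fun u _ hu => ?_]
  · simp only [gridExpansion, Finset.mul_sum, Finset.sum_mul]
    rw [Finset.sum_comm]
    refine Finset.sum_congr rfl fun u _ => ?_
    rw [Finset.sum_comm]
    refine Finset.sum_congr rfl fun c _ => Finset.sum_congr rfl fun i _ => ?_
    split_ifs <;> ring
  · by_contra hempty
    simp [Finset.not_nonempty_iff_eq_empty.1 hempty, hw] at hu

/-- The Koksma–Hlawka inequality for a finitely supported signed measure of total mass zero. -/
theorem ofReal_abs_sum_mul_le {ι : Type*} [Fintype ι] (f : (Fin s → ℝ) → ℝ) {w : ι → ℝ}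
    (hw : ∑ i, w i = 0) {p : ι → Fin s → ℝ} (hp : ∀ i, p i ∈ cube s) {D : ℝ}
    (hD : ∀ z : Fin s → ℝ, (∀ j, Irrational (z j)) →
      |∑ i, if ∀ j, p i j < z j then w i else 0| ≤ D) :
    ENNReal.ofReal |∑ i, w i * f (p i)| ≤ hardyKrauseVariation f * ENNReal.ofReal D := by
  classical
  obtain ⟨N, g, hmono, hg, h0, hN, hgrid⟩ :=
    exists_grid (Finset.univ.image fun q : ι × Fin s => p q.1 q.2) (by
      simp only [Finset.mem_image, Finset.mem_univ, true_and]
      rintro _ ⟨q, rfl⟩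
      exact ⟨(hp q.1).1 q.2, (hp q.1).2 q.2⟩)
  replace hgrid (i j) : p i j ∈ g '' Set.Iic N :=
    hgrid _ (Finset.mem_image_of_mem (fun q : ι × Fin s => p q.1 q.2) (Finset.mem_univ (i, j)))
  have hbox (u) (c) (hc : c ∈ gridCells N u) :
      |∑ i, if ∀ j ∈ u, p i j ≤ g (c j) then w i else 0| ≤ D := by
    obtain ⟨z, hz, hzc⟩ := exists_irrational_forall_lt_iff hmono hg hN hc
    simpa only [hzc _ (hgrid _)] using hD z hz
  rw [Finset.sum_congr rfl fun i _ => by rw [← gridExpansion_eq hg hN f (hgrid i)],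
    sum_mul_gridExpansion f w p hw, hardyKrauseVariation, Finset.sum_mul]
  refine (ENNReal.ofReal_le_ofReal (Finset.abs_sum_le_sum_abs _ _)).trans ?_
  rw [ENNReal.ofReal_sum_of_nonneg fun _ _ => abs_nonneg _]
  refine Finset.sum_le_sum fun u _ => ?_
  grw [← sum_ofReal_abs_increment_le_vitaliVariation f hmono h0 hN u]
  rw [abs_mul, abs_pow, abs_neg, abs_one, one_pow, one_mul,
    ← ENNReal.ofReal_sum_of_nonneg fun _ _ => abs_nonneg _,
    ← ENNReal.ofReal_mul (Finset.sum_nonneg fun _ _ => abs_nonneg _), Finset.sum_mul]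
  refine ENNReal.ofReal_le_ofReal ((Finset.abs_sum_le_sum_abs _ _).trans ?_)
  refine Finset.sum_le_sum fun c hc => ?_
  rw [abs_mul, mul_comm]
  exact mul_le_mul_of_nonneg_left (hbox u c hc) (abs_nonneg _)

end KoksmaHlawka

section StratifiedSample

open scoped BigOperators

variable {s K : ℕ}

/-- The half-open unit cube `[0,1)^s`. Its scaled translates partition it, which those of the closed
cube do not. -/
def unitBox (s : ℕ) : Set (Fin s → ℝ) := Set.univ.pi fun _ => Set.Ico 0 1

/-- The cell with index `k` of the partition of `[0,1)^s` into cubes of side length `1 / K`. -/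
def subcube (K : ℕ) (k : Fin s → Fin K) : Set (Fin s → ℝ) :=
  {x | (K : ℝ) • x - (fun j => ((k j : ℕ) : ℝ)) ∈ unitBox s}

/-- The point of `subcube K k` with relative position `y`. For a fixed offset `y`, these points form
a stratified sample of the unit cube. -/
noncomputable def stratifiedPoint (K : ℕ) (y : Fin s → ℝ) (k : Fin s → Fin K) : Fin s → ℝ :=
  (K : ℝ)⁻¹ • ((fun j => ((k j : ℕ) : ℝ)) + y)

lemma unitBox_ae_eq_cube (s : ℕ) : (unitBox s : Set (Fin s → ℝ)) =ᵐ[volume] cube s :=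
  Measure.univ_pi_Ico_ae_eq_Icc

lemma measurableSet_unitBox (s : ℕ) : MeasurableSet (unitBox s) :=
  MeasurableSet.univ_pi fun _ => measurableSet_Ico

lemma mem_subcube {k : Fin s → Fin K} {x : Fin s → ℝ} :
    x ∈ subcube K k ↔ ∀ j, ((k j : ℕ) : ℝ) ≤ K * x j ∧ K * x j < (k j : ℕ) + 1 := by
  simp only [subcube, unitBox, Set.mem_ofPred_eq, Set.mem_univ_pi, Set.mem_Ico, Pi.sub_apply,
    Pi.smul_apply, smul_eq_mul, sub_nonneg, sub_lt_iff_lt_add']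

lemma measurableSet_subcube (k : Fin s → Fin K) : MeasurableSet (subcube K k) :=
  measurableSet_preimage (f := fun x : Fin s → ℝ => (K : ℝ) • x - fun j => ((k j : ℕ) : ℝ))
    (by fun_prop) (measurableSet_unitBox s)

lemma pairwise_disjoint_subcube :
    Pairwise (Function.onFun Disjoint fun k : Fin s → Fin K => subcube K k) := by
  intro k k' hkk'
  refine Set.disjoint_left.2 fun x hx hx' => hkk' (funext fun j => Fin.ext ?_)
  obtain ⟨hle, hlt⟩ := mem_subcube.1 hx j
  obtain ⟨hle', hlt'⟩ := mem_subcube.1 hx' j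
  have hkk'_lt : ((k j : ℕ) : ℝ) < (k' j : ℕ) + 1 := hle.trans_lt hlt'
  have hk'k_lt : ((k' j : ℕ) : ℝ) < (k j : ℕ) + 1 := hle'.trans_lt hlt
  norm_cast at hkk'_lt hk'k_lt
  omega

variable [NeZero K]

lemma iUnion_subcube : ⋃ k : Fin s → Fin K, subcube K k = unitBox s := by
  have hK : (0 : ℝ) < K := by exact_mod_cast NeZero.pos K
  ext x
  simp only [Set.mem_iUnion, mem_subcube, unitBox, Set.mem_univ_pi, Set.mem_Ico]
  constructor
  · rintro ⟨k, hk⟩ j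
    have hkK : ((k j : ℕ) : ℝ) + 1 ≤ K := by exact_mod_cast (k j).2
    obtain ⟨hle, hlt⟩ := hk j
    exact ⟨(mul_nonneg_iff_of_pos_left hK).1 ((Nat.cast_nonneg _).trans hle),
      (mul_lt_iff_lt_one_right hK).1 (hlt.trans_le hkK)⟩
  · intro hx
    have h0 (j) : 0 ≤ K * x j := mul_nonneg hK.le (hx j).1
    refine ⟨fun j => ⟨⌊K * x j⌋₊, (Nat.floor_lt (h0 j)).2 ?_⟩, fun j =>
      ⟨Nat.floor_le (h0 j), Nat.lt_floor_add_one _⟩⟩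
    exact mul_lt_of_lt_one_right hK (hx j).2

lemma subcube_subset_unitBox (k : Fin s → Fin K) : subcube K k ⊆ unitBox s :=
  iUnion_subcube (K := K) ▸ Set.subset_iUnion _ k

lemma stratifiedPoint_mem_subcube {y : Fin s → ℝ} {k : Fin s → Fin K} :
    stratifiedPoint K y k ∈ subcube K k ↔ y ∈ unitBox s := by
  simp only [subcube, stratifiedPoint, Set.mem_ofPred_eq,
    smul_inv_smul₀ (Nat.cast_ne_zero.2 (NeZero.ne K) : (K : ℝ) ≠ 0), add_sub_cancel_left]

lemma stratifiedPoint_mem_cube {y : Fin s → ℝ} (hy : y ∈ cube s) (k : Fin s → Fin K) :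
    stratifiedPoint K y k ∈ cube s := by
  have hK : (0 : ℝ) < K := by exact_mod_cast NeZero.pos K
  refine ⟨fun j => mul_nonneg (inv_nonneg.2 hK.le) (add_nonneg (Nat.cast_nonneg _) (hy.1 j)),
    fun j => (inv_mul_le_one₀ hK).2 ?_⟩
  have hkK : ((k j : ℕ) : ℝ) + 1 ≤ K := by exact_mod_cast (k j).2
  exact (add_le_add_right (hy.2 j) _).trans hkK

lemma indicator_unitBox_comp_stratifiedPoint (f : (Fin s → ℝ) → ℝ) (k : Fin s → Fin K) :
    (unitBox s).indicator (fun y => f (stratifiedPoint K y k))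
      = fun y => (subcube K k).indicator f (stratifiedPoint K y k) := by
  classical
  ext y
  rw [Set.indicator_apply, Set.indicator_apply]
  exact if_congr stratifiedPoint_mem_subcube.symm rfl rfl

lemma integrableOn_comp_stratifiedPoint {f : (Fin s → ℝ) → ℝ} (hf : IntegrableOn f (unitBox s))
    (k : Fin s → Fin K) : IntegrableOn (fun y => f (stratifiedPoint K y k)) (unitBox s) := by
  have hK : (K : ℝ)⁻¹ ≠ 0 := inv_ne_zero (Nat.cast_ne_zero.2 (NeZero.ne K))
  have hcell : Integrable ((subcube K k).indicator f) :=
    (integrable_indicator_iff (measurableSet_subcube k)).2 (hf.mono_set (subcube_subset_unitBox k))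
  rw [← integrable_indicator_iff (measurableSet_unitBox s), indicator_unitBox_comp_stratifiedPoint]
  exact (hcell.comp_smul hK).comp_add_left fun j => ((k j : ℕ) : ℝ)

lemma setIntegral_comp_stratifiedPoint (f : (Fin s → ℝ) → ℝ) (k : Fin s → Fin K) :
    ∫ y in unitBox s, f (stratifiedPoint K y k) = K ^ s * ∫ x in subcube K k, f x := by
  rw [← integral_indicator (measurableSet_unitBox s), indicator_unitBox_comp_stratifiedPoint,
    ← integral_indicator (measurableSet_subcube k)]
  have htranslate := integral_add_left_eq_self (μ := (volume : Measure (Fin s → ℝ)))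
    (fun y => (subcube K k).indicator f ((K : ℝ)⁻¹ • y)) fun j => ((k j : ℕ) : ℝ)
  rwa [Measure.integral_comp_inv_smul, Module.finrank_fin_fun, abs_of_nonneg (by positivity),
    smul_eq_mul] at htranslate

lemma integrableOn_expect_stratifiedPoint {f : (Fin s → ℝ) → ℝ} (hf : IntegrableOn f (cube s)) :
    IntegrableOn (fun y => 𝔼 k, f (stratifiedPoint K y k)) (cube s) := by
  refine IntegrableOn.congr_set_ae ?_ (unitBox_ae_eq_cube s).symm
  simp only [Fintype.expect_eq_sum_div_card]
  exact (integrable_finsetSum _ fun k _ => integrableOn_comp_stratifiedPoint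
    (hf.congr_set_ae (unitBox_ae_eq_cube s)) k).div_const _

lemma setIntegral_expect_stratifiedPoint {f : (Fin s → ℝ) → ℝ} (hf : IntegrableOn f (cube s)) :
    ∫ y in cube s, 𝔼 k, f (stratifiedPoint K y k) = ∫ x in cube s, f x := by
  have hfb : IntegrableOn f (unitBox s) := hf.congr_set_ae (unitBox_ae_eq_cube s)
  have hK : (K : ℝ) ^ s ≠ 0 := pow_ne_zero s (Nat.cast_ne_zero.2 (NeZero.ne K))
  simp only [← setIntegral_congr_set (unitBox_ae_eq_cube s), Fintype.expect_eq_sum_div_card]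
  rw [integral_div, integral_finsetSum _ fun k _ => integrableOn_comp_stratifiedPoint hfb k]
  simp only [setIntegral_comp_stratifiedPoint, ← Finset.mul_sum]
  rw [← integral_iUnion_fintype measurableSet_subcube pairwise_disjoint_subcube
    fun k => hfb.mono_set (subcube_subset_unitBox k), iUnion_subcube]
  simp [hK]

lemma abs_prod_sub_prod_le {ι : Type*} (T : Finset ι) {a b : ι → ℝ}
    (ha : ∀ j ∈ T, a j ∈ Set.Icc (0 : ℝ) 1) (hb : ∀ j ∈ T, b j ∈ Set.Icc (0 : ℝ) 1) :
    |∏ j ∈ T, a j - ∏ j ∈ T, b j| ≤ ∑ j ∈ T, |a j - b j| := by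
  classical
  induction T using Finset.induction_on with
  | empty => simp
  | insert j T hj ih =>
    obtain ⟨⟨ha0, ha1⟩, haT⟩ := Finset.forall_mem_insert .. |>.1 ha
    obtain ⟨-, hbT⟩ := Finset.forall_mem_insert .. |>.1 hb
    have hB0 : 0 ≤ ∏ i ∈ T, b i := Finset.prod_nonneg fun i hi => (hbT i hi).1
    have hB1 : ∏ i ∈ T, b i ≤ 1 :=
      Finset.prod_le_one (fun i hi => (hbT i hi).1) fun i hi => (hbT i hi).2
    rw [Finset.prod_insert hj, Finset.prod_insert hj, Finset.sum_insert hj]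
    calc |a j * ∏ i ∈ T, a i - b j * ∏ i ∈ T, b i|
        = |(a j - b j) * ∏ i ∈ T, b i + a j * (∏ i ∈ T, a i - ∏ i ∈ T, b i)| := by ring_nf
      _ ≤ |a j - b j| * ∏ i ∈ T, b i + a j * |∏ i ∈ T, a i - ∏ i ∈ T, b i| := by
          refine (abs_add_le _ _).trans_eq ?_
          rw [abs_mul, abs_mul, abs_of_nonneg hB0, abs_of_nonneg ha0]
      _ ≤ |a j - b j| + |∏ i ∈ T, a i - ∏ i ∈ T, b i| :=
          add_le_add (mul_le_of_le_one_right (abs_nonneg _) hB1)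
            (mul_le_of_le_one_left (abs_nonneg _) ha1)
      _ ≤ _ := by grw [ih haT hbT]

lemma card_filter_inv_mul_add_lt (y z : ℝ) :
    (Finset.univ.filter fun a : Fin K => (K : ℝ)⁻¹ * ((a : ℕ) + y) < z).card
      = min K ⌈K * z - y⌉₊ := by
  have hK : (0 : ℝ) < K := by exact_mod_cast NeZero.pos K
  rw [← Fin.card_filter_val_lt]
  congr 1
  refine Finset.filter_congr fun a _ => ?_
  rw [Nat.lt_ceil, inv_mul_lt_iff₀ hK, lt_sub_iff_add_lt]

lemma abs_natCeil_sub_sub_max_le {x y : ℝ} (hy : y ∈ Set.Icc (0 : ℝ) 1) :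
    |(⌈x - y⌉₊ : ℝ) - max 0 x| ≤ 1 := by
  rw [abs_le]
  rcases le_total (x - y) 0 with h | h
  · rw [Nat.ceil_eq_zero.2 h, Nat.cast_zero]
    constructor <;> grind
  · rw [max_eq_right (by linarith [hy.1])]
    constructor <;> linarith [hy.1, hy.2, Nat.le_ceil (x - y), Nat.ceil_lt_add_one h]

lemma abs_card_filter_div_sub_unitClamp_le {y : ℝ} (hy : y ∈ Set.Icc (0 : ℝ) 1) (z : ℝ) :
    |((Finset.univ.filter fun a : Fin K => (K : ℝ)⁻¹ * ((a : ℕ) + y) < z).card : ℝ) / K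
      - unitClamp z| ≤ 1 / K := by
  have hK : (0 : ℝ) < K := by exact_mod_cast NeZero.pos K
  have hclamp : K * unitClamp z = min (K : ℝ) (max 0 (K * z)) := by
    rw [unitClamp, mul_max_of_nonneg _ _ hK.le, mul_min_of_nonneg _ _ hK.le, mul_zero, mul_one,
      max_min_distrib_left, max_eq_right hK.le, min_comm]
  rw [card_filter_inv_mul_add_lt, div_sub' hK.ne', abs_div, abs_of_pos hK,
    div_le_div_iff_of_pos_right hK, hclamp, Nat.cast_min]
  refine (abs_min_sub_min_le_max _ _ _ _).trans ?_
  rw [sub_self, abs_zero]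
  exact max_le zero_le_one (abs_natCeil_sub_sub_max_le hy)

lemma localDiscrepancy_stratifiedPoint (y z : Fin s → ℝ) :
    localDiscrepancy Finset.univ (stratifiedPoint K y) z
      = K ^ s * (∏ j, ((Finset.univ.filter fun a : Fin K =>
          (K : ℝ)⁻¹ * ((a : ℕ) + y j) < z j).card : ℝ) / K - ∏ j, unitClamp (z j)) := by
  have hK : (K : ℝ) ^ s ≠ 0 := pow_ne_zero s (Nat.cast_ne_zero.2 (NeZero.ne K))
  have hbox (k : Fin s → Fin K) :
      (k ∈ Fintype.piFinset fun j => Finset.univ.filter fun a : Fin K =>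
        (K : ℝ)⁻¹ * ((a : ℕ) + y j) < z j)
      ↔ k ∈ Finset.univ ∧ ∀ j, stratifiedPoint K y k j < z j := by
    simp [stratifiedPoint]
  rw [localDiscrepancy_eq_card_sub hbox, Fintype.card_piFinset, Finset.prod_div_distrib, mul_sub]
  simp [mul_div_cancel₀ _ hK]

lemma abs_localDiscrepancy_stratifiedPoint_le {y : Fin s → ℝ} (hy : y ∈ cube s)
    (z : Fin s → ℝ) :
    |localDiscrepancy Finset.univ (stratifiedPoint K y) z|
      ≤ s / K * Fintype.card (Fin s → Fin K) := by
  have hK : (0 : ℝ) < K := by exact_mod_cast NeZero.pos K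
  rw [localDiscrepancy_stratifiedPoint, abs_mul, abs_of_pos (pow_pos hK s), mul_comm,
    Fintype.card_fun, Fintype.card_fin, Fintype.card_fin, Nat.cast_pow]
  gcongr
  refine (abs_prod_sub_prod_le _ (fun j _ => ⟨by positivity, (div_le_one hK).2 ?_⟩) fun j _ =>
    ⟨unitClamp_nonneg _, unitClamp_le_one _⟩).trans ?_
  · exact_mod_cast (Finset.card_le_univ _).trans_eq (Fintype.card_fin K)
  · refine (Finset.sum_le_sum fun j _ =>
      abs_card_filter_div_sub_unitClamp_le ⟨hy.1 j, hy.2 j⟩ (z j)).trans_eq ?_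
    simp [div_eq_mul_inv]

end StratifiedSample

section WorstCaseError

open scoped BigOperators

variable {s : ℕ} {ι κ : Type*} [Fintype ι] [Fintype κ]
  {f : (Fin s → ℝ) → ℝ} {p : ι → Fin s → ℝ}

instance isProbabilityMeasure_restrict_cube (s : ℕ) :
    IsProbabilityMeasure (volume.restrict (cube s)) :=
  ⟨by simp [cube, Real.volume_Icc_pi]⟩

lemma ofReal_abs_sub_integral_le {α : Type*} [MeasurableSpace α] {μ : Measure α}
    [IsProbabilityMeasure μ] {h : α → ℝ} (hh : Integrable h μ) {c : ℝ} {B : ℝ≥0∞}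
    (hB : ∀ᵐ y ∂μ, ENNReal.ofReal |c - h y| ≤ B) :
    ENNReal.ofReal |c - ∫ y, h y ∂μ| ≤ B := by
  simp only [← Real.enorm_eq_ofReal_abs] at hB ⊢
  have hdiff : c - ∫ y, h y ∂μ = ∫ y, (c - h y) ∂μ := by
    rw [integral_sub (integrable_const c) hh, integral_const, probReal_univ, one_smul]
  calc ‖c - ∫ y, h y ∂μ‖ₑ ≤ ∫⁻ y, ‖c - h y‖ₑ ∂μ := hdiff ▸ enorm_integral_le_lintegral_enorm _
    _ ≤ ∫⁻ _, B ∂μ := lintegral_mono_ae hB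
    _ = B := by rw [lintegral_const, measure_univ, mul_one]

lemma sum_ite_forall_lt_eq (p : ι → Fin s → ℝ) (z : Fin s → ℝ) (c : ℝ) :
    ∑ i, (if ∀ j, p i j < z j then c else 0)
      = c * (localDiscrepancy Finset.univ p z + Fintype.card ι * ∏ j, unitClamp (z j)) := by
  rw [localDiscrepancy_eq_card_sub (T := Finset.univ.filter fun i => ∀ j, p i j < z j) (by simp),
    Finset.card_univ, sub_add_cancel, ← Finset.sum_filter, Finset.sum_const, nsmul_eq_mul, mul_comm]

variable [Nonempty ι] [Nonempty κ]

lemma ofReal_abs_expect_sub_le_oscillation (hp : ∀ i, p i ∈ cube s) {y : Fin s → ℝ}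
    (hy : y ∈ cube s) : ENNReal.ofReal |𝔼 i, f (p i) - f y| ≤ oscillation f := by
  have hosc {x x'} (hx : x ∈ cube s) (hx' : x' ∈ cube s) :
      ENNReal.ofReal (f x - f x') ≤ oscillation f :=
    le_iSup₂_of_le x hx (le_iSup₂_of_le x' hx' le_rfl)
  rcases eq_or_ne (oscillation f) ∞ with htop | htop
  · exact htop ▸ le_top
  simp only [ENNReal.ofReal_le_iff_le_toReal htop] at hosc ⊢
  rw [← Fintype.expect_const (ι := ι) (f y), ← Finset.expect_sub_distrib]
  refine (Finset.abs_expect_le _ _).trans (Finset.expect_le Finset.univ_nonempty fun i _ => ?_)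
  exact abs_sub_le_iff.2 ⟨hosc (hp i) hy, hosc hy (hp i)⟩

lemma ofReal_abs_expect_sub_expect_le (f : (Fin s → ℝ) → ℝ) (hp : ∀ i, p i ∈ cube s)
    {q : κ → Fin s → ℝ} (hq : ∀ k, q k ∈ cube s) {D E : ℝ}
    (hD : ∀ z : Fin s → ℝ, (∀ j, Irrational (z j)) →
      |localDiscrepancy Finset.univ p z| ≤ D * Fintype.card ι)
    (hE : ∀ z : Fin s → ℝ, (∀ j, Irrational (z j)) →
      |localDiscrepancy Finset.univ q z| ≤ E * Fintype.card κ) :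
    ENNReal.ofReal |𝔼 i, f (p i) - 𝔼 k, f (q k)|
      ≤ hardyKrauseVariation f * ENNReal.ofReal (D + E) := by
  have hι : (0 : ℝ) < Fintype.card ι := by exact_mod_cast Fintype.card_pos
  have hκ : (0 : ℝ) < Fintype.card κ := by exact_mod_cast Fintype.card_pos
  set w : ι ⊕ κ → ℝ := Sum.elim (fun _ => (Fintype.card ι : ℝ)⁻¹) fun _ => -(Fintype.card κ : ℝ)⁻¹
  have hw : ∑ i, w i = 0 := by simp [w, Fintype.sum_sum_type, hι.ne', hκ.ne']
  have hmean : 𝔼 i, f (p i) - 𝔼 k, f (q k) = ∑ i, w i * f (Sum.elim p q i) := by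
    simp [w, Fintype.sum_sum_type, Fintype.expect_eq_sum_div_card, ← Finset.mul_sum,
      div_eq_inv_mul, sub_eq_add_neg]
  have hdisc (z : Fin s → ℝ) : ∑ i, (if ∀ j, Sum.elim p q i j < z j then w i else 0)
      = localDiscrepancy Finset.univ p z / Fintype.card ι
        - localDiscrepancy Finset.univ q z / Fintype.card κ := by
    refine (Fintype.sum_sum_type _).trans ((congrArg₂ (· + ·)
      (sum_ite_forall_lt_eq p z (Fintype.card ι : ℝ)⁻¹)
      (sum_ite_forall_lt_eq q z (-(Fintype.card κ : ℝ)⁻¹))).trans ?_)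
    field_simp
    ring
  rw [hmean]
  refine ofReal_abs_sum_mul_le f hw (Sum.forall.2 ⟨hp, hq⟩) fun z hz => ?_
  rw [hdisc]
  refine (abs_sub _ _).trans ?_
  rw [abs_div, abs_div, abs_of_pos hι, abs_of_pos hκ]
  exact add_le_add ((div_le_iff₀ hι).2 (hD z hz)) ((div_le_iff₀ hκ).2 (hE z hz))

/-- The integral is the mean of `f` over a stratified sample, averaged over the offset of the
sample; its discrepancy tends to zero as the cells shrink. -/
theorem ofReal_abs_expect_sub_setIntegral_le (hf : IntegrableOn f (cube s))
    (hp : ∀ i, p i ∈ cube s) {D : ℝ} (hD0 : 0 < D)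
    (hD : ∀ z : Fin s → ℝ, (∀ j, Irrational (z j)) →
      |localDiscrepancy Finset.univ p z| ≤ D * Fintype.card ι) :
    ENNReal.ofReal |𝔼 i, f (p i) - ∫ x in cube s, f x|
      ≤ hardyKrauseVariation f * ENNReal.ofReal D := by
  have hbound (K : ℕ) (hK : 1 ≤ K) : ENNReal.ofReal |𝔼 i, f (p i) - ∫ x in cube s, f x|
      ≤ hardyKrauseVariation f * ENNReal.ofReal (D + s / K) := by
    have : NeZero K := ⟨by omega⟩
    rw [← setIntegral_expect_stratifiedPoint (K := K) hf]
    refine ofReal_abs_sub_integral_le (integrableOn_expect_stratifiedPoint hf)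
      (ae_restrict_of_forall_mem measurableSet_Icc fun y hy => ?_)
    exact ofReal_abs_expect_sub_expect_le f hp (stratifiedPoint_mem_cube hy) hD
      fun z _ => abs_localDiscrepancy_stratifiedPoint_le hy z
  have hlim : Filter.Tendsto (fun K : ℕ => ENNReal.ofReal (D + s / K)) Filter.atTop
      (nhds (ENNReal.ofReal D)) := by
    refine ENNReal.tendsto_ofReal ?_
    simpa using (tendsto_const_div_atTop_nhds_zero_nat (s : ℝ)).const_add D
  exact ge_of_tendsto (ENNReal.Tendsto.const_mul hlim (.inl (ENNReal.ofReal_pos.2 hD0).ne'))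
    (Filter.eventually_atTop.2 ⟨1, hbound⟩)

lemma estimate_eq_expect {m : ℕ} (f : (Fin s → ℝ) → ℝ)
    (C : Fin s → Matrix (Fin m) (Fin m) (ZMod 2)) (M : Fin s → Matrix ℕ (Fin m) (ZMod 2))
    (D : Fin s → ℕ → ZMod 2) : estimate f C M D = 𝔼 i, f (scrambledPoint C M D i) := by
  simp [estimate, Fintype.expect_eq_sum_div_card, div_eq_inv_mul]

lemma scrambledPoint_mem_cube {m : ℕ} (C : Fin s → Matrix (Fin m) (Fin m) (ZMod 2))
    (M : Fin s → Matrix ℕ (Fin m) (ZMod 2)) (D : Fin s → ℕ → ZMod 2) (i : Fin (2 ^ m)) :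
    scrambledPoint C M D i ∈ cube s := by
  rw [scrambledPoint_eq_binaryValue]
  exact ⟨fun _ => binaryValue_nonneg _, fun _ => binaryValue_le_one _⟩

lemma abs_localDiscrepancy_scrambledPoint_le {m t : ℕ}
    {C : Fin s → Matrix (Fin m) (Fin m) (ZMod 2)} (hC : IsDigitalNet t C)
    {M : Fin s → Matrix ℕ (Fin m) (ZMod 2)} (hM : ∀ j, IsUnitLowerTriangular (M j))
    (D : Fin s → ℕ → ZMod 2) {z : Fin s → ℝ} (hz : ∀ j, Irrational (z j)) :
    |localDiscrepancy Finset.univ (scrambledPoint C M D) z|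
      ≤ (∑ i ∈ Finset.range s, ((m - t).choose i : ℝ)) / 2 ^ (m - t) * 2 ^ m := by
  have hpow : (2 : ℝ) ^ m = 2 ^ (m - t) * 2 ^ t := by
    rw [← pow_add, Nat.sub_add_cancel (IsNet.le hC)]
  rw [scrambledPoint_eq_binaryValue]
  refine ((hC.digitNet_scrambledDigit D hM).abs_localDiscrepancy_le hz).trans ?_
  rw [hpow, div_mul_eq_mul_div, mul_left_comm, mul_div_cancel_left₀ _ (by positivity), mul_comm]
  gcongr
  exact (Finset.card_le_univ _).trans_eq (Fintype.card_fin s)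

theorem ofReal_abs_estimate_sub_setIntegral_le (hs : 1 ≤ s) (hf : IntegrableOn f (cube s))
    {m t : ℕ} {C : Fin s → Matrix (Fin m) (Fin m) (ZMod 2)} (hC : IsDigitalNet t C)
    {M : Fin s → Matrix ℕ (Fin m) (ZMod 2)} (hM : ∀ j, IsUnitLowerTriangular (M j))
    (D : Fin s → ℕ → ZMod 2) :
    ENNReal.ofReal |estimate f C M D - ∫ x in cube s, f x| ≤ errorBound t m f := by
  have hp := scrambledPoint_mem_cube C M D
  rw [estimate_eq_expect]
  refine le_min (ofReal_abs_sub_integral_le hf <| ae_restrict_of_forall_mem measurableSet_Icc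
    fun y hy => ofReal_abs_expect_sub_le_oscillation hp hy) ?_
  set B : ℝ := ∑ i ∈ Finset.range s, ((m - t).choose i : ℝ) with hB
  have hBpos : 0 < B := Finset.sum_pos' (fun _ _ => Nat.cast_nonneg _)
    ⟨0, Finset.mem_range.2 hs, by simp⟩
  have hBE : ∑ i ∈ Finset.range s, ((m - t).choose i : ℝ≥0∞) = ENNReal.ofReal B := by
    rw [hB, ENNReal.ofReal_sum_of_nonneg fun _ _ => Nat.cast_nonneg _]
    simp only [ENNReal.ofReal_natCast]
  refine (ofReal_abs_expect_sub_setIntegral_le hf hp (D := B / 2 ^ (m - t)) (by positivity)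
    fun z hz => ?_).trans_eq ?_
  · simpa using abs_localDiscrepancy_scrambledPoint_le hC hM D hz
  · rw [hBE, ENNReal.ofReal_div_of_pos (by positivity), ENNReal.ofReal_pow zero_le_two,
      ENNReal.ofReal_ofNat, div_eq_mul_inv, div_eq_mul_inv, mul_right_comm, mul_assoc]

end WorstCaseError

end MedianQMC

theorem mainTheorem8_general {s m t r : ℕ} (hs : 1 ≤ s) (hr : 0 < r)
    (f : (Fin s → ℝ) → ℝ) (hf : IntegrableOn f (MedianQMC.cube s))
    (C : Fin s → Matrix (Fin m) (Fin m) (ZMod 2)) (hC : MedianQMC.IsDigitalNet t C)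
    {Ω : Type*} [MeasurableSpace Ω] (P : Measure Ω) [IsProbabilityMeasure P]
    (M : Ω → Fin s → Matrix ℕ (Fin m) (ZMod 2)) (D : Ω → Fin s → ℕ → ZMod 2)
    (hM : ∀ᵐ ω ∂P, ∀ j, MedianQMC.IsUnitLowerTriangular (M ω j))
    (A : Set Ω) (hA0 : P Aᶜ ≠ 0) (δ : ℝ≥0∞) (hδ : δ ≠ 0) (hAδ : P A ≤ δ)
    (hunbiased : ∫ ω, MedianQMC.estimate f C (M ω) (D ω) ∂P[|Aᶜ]
      = ∫ x in MedianQMC.cube s, f x)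
    {Ω' : Type*} [MeasurableSpace Ω'] (P' : Measure Ω') [IsProbabilityMeasure P']
    (X : Fin (2 * r - 1) → Ω' → ℝ) (hXindep : iIndepFun X P')
    (hXlaw : ∀ k, IdentDistrib (X k) (fun ω => MedianQMC.estimate f C (M ω) (D ω)) P' P) :
    ∫⁻ ω, ENNReal.ofReal
        ((MedianQMC.sampleMedian hr (fun k => X k ω) - ∫ x in MedianQMC.cube s, f x) ^ 2) ∂P'
      ≤ P Aᶜ * evariance (fun ω => MedianQMC.estimate f C (M ω) (D ω)) P[|Aᶜ] / δ
        + (8 * δ) ^ r * MedianQMC.errorBound t m f ^ 2 := by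
  have herror : ∀ᵐ ω ∂P, ENNReal.ofReal
      |MedianQMC.estimate f C (M ω) (D ω) - ∫ x in MedianQMC.cube s, f x|
        ≤ MedianQMC.errorBound t m f := by
    filter_upwards [hM] with ω hω
    exact MedianQMC.ofReal_abs_estimate_sub_setIntegral_le hs hf hC hω (D ω)
  rw [← hunbiased] at herror ⊢
  exact MedianQMC.lintegral_sampleMedian_sub_sq_le hr hA0 hδ hAδ herror hXindep hXlaw

theorem mainTheorem8 {s m t r : ℕ} (hs : 1 ≤ s) (hr : 0 < r)
    (f : (Fin s → ℝ) → ℝ) (hf : MemLp f 2 (volume.restrict (MedianQMC.cube s)))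
    (C : Fin s → Matrix (Fin m) (Fin m) (ZMod 2)) (hC : MedianQMC.IsDigitalNet t C)
    {Ω : Type*} [MeasurableSpace Ω] (P : Measure Ω) [IsProbabilityMeasure P]
    (M : Ω → Fin s → Matrix ℕ (Fin m) (ZMod 2)) (D : Ω → Fin s → ℕ → ZMod 2)
    (hMD : MedianQMC.IsRandomLinearScramble P M D)
    (A : Set Ω) (hA : MeasurableSet A) (hA0 : P Aᶜ ≠ 0)
    (δ : ℝ) (hδ : 0 < δ) (hAδ : P A ≤ ENNReal.ofReal δ)
    (hunbiased : ∫ ω, MedianQMC.estimate f C (M ω) (D ω) ∂P[|Aᶜ]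
      = ∫ x in MedianQMC.cube s, f x)
    {Ω' : Type*} [MeasurableSpace Ω'] (P' : Measure Ω') [IsProbabilityMeasure P']
    (X : Fin (2 * r - 1) → Ω' → ℝ) (hXindep : iIndepFun X P')
    (hXlaw : ∀ k, IdentDistrib (X k) (fun ω => MedianQMC.estimate f C (M ω) (D ω)) P' P) :
    ∫⁻ ω, ENNReal.ofReal
        ((MedianQMC.sampleMedian hr (fun k => X k ω) - ∫ x in MedianQMC.cube s, f x) ^ 2) ∂P'
      ≤ P Aᶜ * evariance (fun ω => MedianQMC.estimate f C (M ω) (D ω)) P[|Aᶜ]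
          / ENNReal.ofReal δ
        + (8 * ENNReal.ofReal δ) ^ r * MedianQMC.errorBound t m f ^ 2 :=
  mainTheorem8_general hs hr f (hf.integrable one_le_two) C hC P M D
    (.of_forall fun ω j => ⟨hMD.upper ω j, hMD.diag ω j⟩) A hA0 _ (ENNReal.ofReal_pos.2 hδ).ne' hAδ
    hunbiased P' X hXindep hXlaw
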